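/- Let $N\ge 1$ and realise the complex symplectic Lie algebra $sp(N)$ of rank $N$ by the matrices $\begin{pmatrix}A&B\\C&-A^{T}\end{pmatrix}$ with $A,B,C\in M_N(\mathbb C)$, $B,C$ symmetric. With $e_{ij}$ the matrix units of $M_N(\mathbb C)$, put for $1\le i,j\le N$ $$E_{i+j}=\begin{pmatrix}0&e_{ij}+e_{ji}\\0&0\end{pmatrix},\quad F_{i+j}=\begin{pmatrix}0&0\\e_{ij}+e_{ji}&0\end{pmatrix},\quad E_{i-j}=\begin{pmatrix}e_{ij}&0\\0&-e_{ji}\end{pmatrix},\quad F_{i-j}=E_{j-i}\ (i\ne j),\quad H_{ii}=\tfrac12\begin{pmatrix}e_{ii}&0\\0&-e_{ii}\end{pmatrix}.$$ Thus $E_{i\pm j}$ and $F_{i\pm j}$ are root vectors for $\pm(e_i\pm e_j)$, $E_{i+i}$ and $F_{i+i}$ are root vectors for $\pm 2e_i$, and $[H_{ii},E_{i+i}]=E_{i+i}$. The generators with indices in $\{2,\dots,N\}$ span the subalgebra $sp(N-1)\subset sp(N)$ whose roots are orthogonal to $2e_1$. Let $\xi$ be a formal parameter. Consider $U(sp(N))[[\xi]]$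 with its usual coproduct $\Delta$, for which the elements of $sp(N)$ are primitive, with values in $(U(sp(N))\otimes U(sp(N)))[[\xi]]$. Put $\sigma=\ln(1+\xi E_{1+1})$ and $$\mathcal F=\Phi_{\mathcal E_1}\Phi_{\mathcal J_1},\qquad \Phi_{\mathcal J_1}=e^{H_{11}\otimes\sigma},\qquad \Phi_{\mathcal E_1}=e^{\xi E_{1-N}\otimes E_{1+N}e^{-\sigma/2}}\cdots e^{\xi E_{1-2}\otimes E_{1+2}e^{-\sigma/2}}.$$ Then $\mathcal F$ is invertible, and the twisted coproduct $\Delta_{\mathcal E_1}(a)=\mathcal F\Delta(a)\mathcal F^{-1}$ has the following properties. 1. For $2\le i\le N$, and for $2\le i<j\le N$ where $j$ occurs, $$\begin{aligned} \Delta_{\mathcal E_1}(E_{i+i})&=E_{i+i}\otimes1+1\otimes E_{i+i}+2\xi E_{1+i}\otimes E_{1+i}e^{-\sigma/2}+\xi^2E_{1+1}\otimes E_{1+i}^2e^{-\sigma},\\ \Delta_{\mathcal E_1}(E_{i+j})&=E_{i+j}\otimes1+1\otimes E_{i+j}+\xi E_{1+i}\otimes E_{1+j}e^{-\sigma/2}+\xi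 E_{1+j}\otimes E_{1+i}e^{-\sigma/2}+\xi^2E_{1+1}\otimes E_{1+i}E_{1+j}e^{-\sigma},\\ \Delta_{\mathcal E_1}(F_{i+i})&=F_{i+i}\otimes1+1\otimes F_{i+i}+2\xi E_{1-i}\otimes E_{1-i}e^{-\sigma/2}-\xi^2E_{1-i}^2\otimes E_{1+1}e^{-\sigma},\\ \Delta_{\mathcal E_1}(F_{i+j})&=F_{i+j}\otimes1+1\otimes F_{i+j}+\xi E_{1-i}\otimes E_{1-j}e^{-\sigma/2}+\xi E_{1-j}\otimes E_{1-i}e^{-\sigma/2}-\xi^2E_{1-i}E_{1-j}\otimes E_{1+1}e^{-\sigma}, \end{aligned}$$ while $E_{i-j}$, $F_{i-j}$ and $H_{ii}$ remain primitive, where $a$ is called primitive if $\Delta_{\mathcal E_1}(a)=a\otimes1+1\otimes a$. 2. The elements $$\begin{aligned} &E'_{i+j}=E_{i+j}-\xi E_{1+i}E_{1+j}e^{-\sigma},\qquad F'_{i+j}=F_{i+j}-\xi E_{1-i}E_{1-j}&&(2\le i\le j\le N),\\ &E'_{i-j}=E_{i-j},\qquad F'_{i-j}=F_{i-j}&&(2\le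 i<j\le N),\\ &H'_{ii}=H_{ii}&&(2\le i\le N) \end{aligned}$$ of $U(sp(N))[[\xi]]$ are primitive for $\Delta_{\mathcal E_1}$. 3. These elements are linearly independent over $\mathbb C$, and their $\mathbb C$-span is a Lie algebra under the commutator; the linear map from $sp(N-1)$ to this span that sends each generator $X$ to $X'$ is an isomorphism of Lie algebras. -/

import Mathlib

open scoped TensorProduct PowerSeries

namespace SpTwist

attribute [local instance 100] LieRing.ofAssociativeRing

/-! ### The symplectic Lie algebra and its root vectors

`sp(N)` is realised by the `2N × 2N` complex matrices `(A, B; C, -Aᵀ)` with `B`, `C` symmetric. -/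

/-- The Lie algebra `sp(N)` of rank `N` over `ℂ`. -/
abbrev Sp (N : ℕ) : LieSubalgebra ℂ (Matrix (Fin N ⊕ Fin N) (Fin N ⊕ Fin N) ℂ) :=
  LieAlgebra.Symplectic.sp (Fin N) ℂ

theorem fromBlocks_mem_Sp {N : ℕ} {A B C : Matrix (Fin N) (Fin N) ℂ}
    (hB : B.transpose = B) (hC : C.transpose = C) :
    Matrix.fromBlocks A B C (-A.transpose) ∈ Sp N := by
  rw [Sp, LieAlgebra.Symplectic.sp, mem_skewAdjointMatricesLieSubalgebra,
    mem_skewAdjointMatricesSubmodule]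
  simp [Matrix.IsSkewAdjoint, Matrix.IsAdjointPair, Matrix.J, Matrix.fromBlocks_transpose,
    Matrix.fromBlocks_multiply, Matrix.fromBlocks_neg, hB, hC]

/-- The vector `E_{i+j}` of root `e_i + e_j`; for `i = j` this is `E_{i+i}`, of root `2 e_i`. -/
def Eplus {N : ℕ} (i j : Fin N) : Sp N :=
  ⟨Matrix.fromBlocks 0 (Matrix.single i j 1 + Matrix.single j i 1) 0 (-Matrix.transpose 0),
    fromBlocks_mem_Sp (by simp [add_comm]) (by simp)⟩

/-- The vector `F_{i+j}` of root `-(e_i + e_j)`; for `i = j` this is `F_{i+i}`, of root `-2 e_i`. -/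
def Fplus {N : ℕ} (i j : Fin N) : Sp N :=
  ⟨Matrix.fromBlocks 0 0 (Matrix.single i j 1 + Matrix.single j i 1) (-Matrix.transpose 0),
    fromBlocks_mem_Sp (by simp) (by simp [add_comm])⟩

/-- The vector `E_{i-j}` of root `e_i - e_j`, for `i ≠ j`. -/
def Eminus {N : ℕ} (i j : Fin N) : Sp N :=
  ⟨Matrix.fromBlocks (Matrix.single i j 1) 0 0 (-(Matrix.single i j 1).transpose),
    fromBlocks_mem_Sp (by simp) (by simp)⟩

/-- The vector `F_{i-j}` of root `-(e_i - e_j)`, for `i ≠ j`. -/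
def Fminus {N : ℕ} (i j : Fin N) : Sp N := Eminus j i

/-- The Cartan generator `H_{ii}`, normalised by `[H_{ii}, E_{i+i}] = E_{i+i}`. -/
noncomputable def Hcartan {N : ℕ} (i : Fin N) : Sp N :=
  ⟨Matrix.fromBlocks (Matrix.single i i (1 / 2)) 0 0 (-(Matrix.single i i (1 / 2)).transpose),
    fromBlocks_mem_Sp (by simp) (by simp)⟩

/-- Labels of the standard basis `E_{i+j}, F_{i+j} (i ≤ j)`, `E_{i-j}, F_{i-j} (i < j)`, `H_{ii}`
of `sp(n)`. -/
inductive Gen (n : ℕ) : Type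
  | Ep (i j : Fin n) (h : i ≤ j)
  | Fp (i j : Fin n) (h : i ≤ j)
  | Em (i j : Fin n) (h : i < j)
  | Fm (i j : Fin n) (h : i < j)
  | H (i : Fin n)

/-- The standard basis of `sp(n)`. -/
noncomputable def gen {n : ℕ} : Gen n → Sp n
  | .Ep i j _ => Eplus i j
  | .Fp i j _ => Fplus i j
  | .Em i j _ => Eminus i j
  | .Fm i j _ => Fminus i j
  | .H i => Hcartan i

/-! ### The Hopf algebra `U(sp(N))[[ξ]]` -/

/-- `U(sp(N))`. -/
abbrev U (N : ℕ) : Type := UniversalEnvelopingAlgebra ℂ (Sp N)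

/-- The primitive coproduct on `sp(N)`. -/
noncomputable def primLie (N : ℕ) : Sp N →ₗ⁅ℂ⁆ U N ⊗[ℂ] U N :=
  { toFun := fun x => UniversalEnvelopingAlgebra.ι ℂ x ⊗ₜ[ℂ] (1 : U N) +
      (1 : U N) ⊗ₜ[ℂ] UniversalEnvelopingAlgebra.ι ℂ x
    map_add' := fun x y => by
      simp only [map_add, TensorProduct.add_tmul, TensorProduct.tmul_add]; abel
    map_smul' := fun c x => by
      simp only [map_smul, TensorProduct.smul_tmul', TensorProduct.tmul_smul, smul_add,
        RingHom.id_apply]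
    map_lie' := fun {x y} => by
      simp only [LieHom.map_lie, LieRing.of_associative_ring_bracket, add_mul, mul_add,
        Algebra.TensorProduct.tmul_mul_tmul, one_mul, mul_one, TensorProduct.sub_tmul,
        TensorProduct.tmul_sub]
      abel }

/-- The coproduct `Δ : U(sp(N)) → U(sp(N)) ⊗ U(sp(N))`. -/
noncomputable def comul (N : ℕ) : U N →ₐ[ℂ] U N ⊗[ℂ] U N :=
  UniversalEnvelopingAlgebra.lift ℂ (primLie N)

/-- The coproduct on `U(sp(N))[[ξ]]`, with values in the completed tensor square
`(U(sp(N)) ⊗ U(sp(N)))[[ξ]]`. -/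
noncomputable def comulξ (N : ℕ) : (U N)⟦X⟧ →ₐ[ℂ] (U N ⊗[ℂ] U N)⟦X⟧ :=
  PowerSeries.mapAlgHom (comul N)

/-- The tensor `a ⊗ b` of two elements of `U(sp(N))[[ξ]]`, in the completed tensor square. -/
noncomputable def tens {N : ℕ} (a b : (U N)⟦X⟧) : (U N ⊗[ℂ] U N)⟦X⟧ :=
  PowerSeries.mapAlgHom (Algebra.TensorProduct.includeLeft : U N →ₐ[ℂ] U N ⊗[ℂ] U N) a *
    PowerSeries.mapAlgHom (Algebra.TensorProduct.includeRight : U N →ₐ[ℂ] U N ⊗[ℂ] U N) b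

infixl:75 " ⊠ " => tens

/-- An element of `sp(N)` as an element of `U(sp(N))[[ξ]]`. -/
noncomputable def emb {N : ℕ} (x : Sp N) : (U N)⟦X⟧ :=
  PowerSeries.C (UniversalEnvelopingAlgebra.ι ℂ x)

/-- The formal parameter `ξ` (a central element). -/
noncomputable abbrev ξ {A : Type*} [Ring A] : A⟦X⟧ := PowerSeries.X

/-- The value `∑ k, a k • x ^ k` of a scalar power series at an element `x` of `A[[ξ]]` with zero
constant term. As `x ^ k` is then divisible by `ξ ^ k`, the terms with `k > m` do not contribute to
the coefficient of `ξ ^ m`. -/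
noncomputable def evalSeries {A : Type*} [Ring A] [Algebra ℂ A] (a : ℕ → ℂ) (x : A⟦X⟧) : A⟦X⟧ :=
  PowerSeries.mk fun m => ∑ k ∈ Finset.range (m + 1), a k • PowerSeries.coeff m (x ^ k)

/-- `exp x = ∑ k, x ^ k / k!`. -/
noncomputable def fexp {A : Type*} [Ring A] [Algebra ℂ A] (x : A⟦X⟧) : A⟦X⟧ :=
  evalSeries (fun k => 1 / (k.factorial : ℂ)) x

/-- `ln (1 + x) = ∑ k ≥ 1, (-1) ^ (k + 1) x ^ k / k`. -/
noncomputable def flog1p {A : Type*} [Ring A] [Algebra ℂ A] (x : A⟦X⟧) : A⟦X⟧ :=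
  evalSeries (fun k => if k = 0 then 0 else (-1) ^ (k + 1) / (k : ℂ)) x

/-! ### The extended jordanian twist with initial root `2 e_1`

The indices `1, 2, …, N` are `0, 1, …, n : Fin (n + 1)` with `N = n + 1`; thus the index `1` is `0`
and the indices `2, …, N` are `i.succ` with `i : Fin n`. -/

/-- `E_{1+1}`. -/
noncomputable def E11 (n : ℕ) : (U (n + 1))⟦X⟧ := emb (Eplus 0 0)

/-- `E_{1+i}`, `i = 2, …, N`. -/
noncomputable def E1p {n : ℕ} (i : Fin n) : (U (n + 1))⟦X⟧ := emb (Eplus 0 i.succ)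

/-- `E_{1-i}`, `i = 2, …, N`. -/
noncomputable def E1m {n : ℕ} (i : Fin n) : (U (n + 1))⟦X⟧ := emb (Eminus 0 i.succ)

/-- `σ_{1+1} = ln (1 + ξ E_{1+1})`. -/
noncomputable def σ (n : ℕ) : (U (n + 1))⟦X⟧ := flog1p (ξ * E11 n)

/-- `e^{c σ_{1+1}}`. -/
noncomputable def expσ (n : ℕ) (c : ℂ) : (U (n + 1))⟦X⟧ := fexp (c • σ n)

/-- The jordanian twist `exp (H_{11} ⊗ σ_{1+1})`. -/
noncomputable def ΦJ (n : ℕ) : (U (n + 1) ⊗[ℂ] U (n + 1))⟦X⟧ :=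
  fexp (emb (Hcartan 0) ⊠ σ n)

/-- The full extension: the product over `i = 2, …, N`, with `i` growing from right to left, of the
factors `exp (ξ E_{1-i} ⊗ E_{1+i} e^{-σ_{1+1}/2})`. -/
noncomputable def ΦE (n : ℕ) : (U (n + 1) ⊗[ℂ] U (n + 1))⟦X⟧ :=
  (List.ofFn fun i : Fin n => fexp (ξ * (E1m i ⊠ (E1p i * expσ n (-1 / 2))))).reverse.prod

/-- The full extended jordanian twist `Φ_{E₁} Φ_{J₁}`. -/
noncomputable def twist (n : ℕ) : (U (n + 1) ⊗[ℂ] U (n + 1))⟦X⟧ := ΦE n * ΦJ n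

/-- The twisted coproduct `a ↦ F Δ(a) F⁻¹`. -/
noncomputable def comulTw (n : ℕ) (a : (U (n + 1))⟦X⟧) : (U (n + 1) ⊗[ℂ] U (n + 1))⟦X⟧ :=
  twist n * comulξ (n + 1) a * Ring.inverse (twist n)

/-- `a` is primitive for the twisted coproduct. -/
def IsPrim {n : ℕ} (a : (U (n + 1))⟦X⟧) : Prop :=
  comulTw n a = a ⊠ 1 + 1 ⊠ a

/-- The modified generators, labelled by the basis of `sp(N-1)`. -/
noncomputable def gen' {n : ℕ} : Gen n → (U (n + 1))⟦X⟧
  | .Ep i j _ => emb (Eplus i.succ j.succ) - ξ * (E1p i * E1p j * expσ n (-1))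
  | .Fp i j _ => emb (Fplus i.succ j.succ) - ξ * (E1m i * E1m j)
  | .Em i j _ => emb (Eminus i.succ j.succ)
  | .Fm i j _ => emb (Fminus i.succ j.succ)
  | .H i => emb (Hcartan i.succ)

end SpTwist

attribute [local instance 100] LieRing.ofAssociativeRing

open SpTwist

/-! Let S be the sum of the E_{1-k} ⊗ E_{1+k} e^{-σ/2}. The E_{1-k} commute with each other, so do
the E_{1+k}, and both commute with σ. Hence the factors of Φ_E commute and Φ_E = exp(ξS) (`ΦE_eq`),
and conjugation by the twist is computed in two stages. If [H_{11}, x] = c x, the jordanian factor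
turns x ⊗ 1 into x ⊗ e^{cσ}; it fixes 1 ⊗ x when x commutes with E_{1+1} (`ΦJ_tens_one`,
`ΦJ_one_tens`). On the elements that then arise (ad S)^3 vanishes, so conjugation by exp(ξS) is a
polynomial of degree at most two in ad(ξS) (`semiconjBy_fexp`). Generators of sp(N-1) have weight c
= 0, and their brackets with E_{1-k} and E_{1+k} give part 1.

The same method yields E_{1+i} ↦ E_{1+i} ⊗ e^{σ/2} + e^σ ⊗ E_{1+i} and E_{1-i} ↦ E_{1-i} ⊗ e^{-σ/2}
+ 1 ⊗ E_{1-i}, and shows that e^σ is group-like. The twisted coproduct is multiplicative, so those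
of E_{1+i} E_{1+j} e^{-σ} and E_{1-i} E_{1-j} follow. Multiplied by ξ, their non-primitive terms are
exactly those of E_{i+j} and F_{i+j}, once e^σ = 1 + ξ E_{1+1} (`fexp_flog1p`) is used to match
them. This is part 2.

For part 3, setting ξ = 0 turns the primed generators into distinct basis vectors of sp(N), which
gives independence. The commutators are checked on root vectors; the only delicate one is [E', F']
(`lie_Eplus'_Fplus'`), where the corrections cancel, again by e^σ = 1 + ξ E_{1+1}. -/

set_option linter.unusedSimpArgs false

namespace SpTwist

attribute [local instance 100] LieRing.ofAssociativeRing

/-! ### Formal exponentials -/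

section FormalExp

variable {A : Type*} [Ring A]

/-- Each factor is divisible by the central element `X`, so the product is divisible by `X ^ (k +
l)`; `x` and `y` need not commute. -/
theorem coeff_pow_mul_pow_eq_zero {x y : A⟦X⟧} (hx : PowerSeries.constantCoeff x = 0)
    (hy : PowerSeries.constantCoeff y = 0) {m k l : ℕ} (h : m < k + l) :
    PowerSeries.coeff m (x ^ k * y ^ l) = 0 := by
  obtain ⟨x', rfl⟩ := PowerSeries.X_dvd_iff.2 hx
  obtain ⟨y', rfl⟩ := PowerSeries.X_dvd_iff.2 hy
  rw [(PowerSeries.commute_X x').symm.mul_pow, (PowerSeries.commute_X y').symm.mul_pow,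
    mul_assoc, ← mul_assoc (x' ^ k), (PowerSeries.commute_X_pow (x' ^ k) l).eq, mul_assoc,
    ← mul_assoc, ← pow_add, PowerSeries.coeff_X_pow_mul', if_neg (by omega)]

theorem coeff_pow_eq_zero {x : A⟦X⟧} (hx : PowerSeries.constantCoeff x = 0) {m k : ℕ}
    (h : m < k) : PowerSeries.coeff m (x ^ k) = 0 := by
  simpa using coeff_pow_mul_pow_eq_zero hx hx (m := m) (k := k) (l := 0) (by simpa using h)

variable [Algebra ℂ A]

/-- The truncation in `evalSeries` depends on `m`. Any longer truncation gives the same coefficient,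
so one finite sum serves all coefficients up to a given degree, and identities of series reduce to
identities of polynomials in `x`. -/
theorem coeff_evalSeries (a : ℕ → ℂ) {x : A⟦X⟧} (hx : PowerSeries.constantCoeff x = 0)
    {m N : ℕ} (h : m < N) :
    PowerSeries.coeff m (evalSeries a x) =
      PowerSeries.coeff m (∑ k ∈ Finset.range N, a k • x ^ k) := by
  simp only [evalSeries, PowerSeries.coeff_mk, map_sum, PowerSeries.coeff_smul]
  refine Finset.sum_subset (by simpa using h) fun k _ hk => ?_
  rw [coeff_pow_eq_zero hx (by simpa using hk), smul_zero]

theorem coeff_evalSeries_mul (a : ℕ → ℂ) {x : A⟦X⟧} (hx : PowerSeries.constantCoeff x = 0)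
    (y : A⟦X⟧) {m N : ℕ} (h : m < N) :
    PowerSeries.coeff m (evalSeries a x * y) =
      PowerSeries.coeff m ((∑ k ∈ Finset.range N, a k • x ^ k) * y) := by
  rw [PowerSeries.coeff_mul, PowerSeries.coeff_mul]
  refine Finset.sum_congr rfl fun p hp => ?_
  have := Finset.HasAntidiagonal.mem_antidiagonal.1 hp
  rw [coeff_evalSeries a hx (by omega : p.1 < N)]

theorem coeff_mul_evalSeries (a : ℕ → ℂ) {x : A⟦X⟧} (hx : PowerSeries.constantCoeff x = 0)
    (y : A⟦X⟧) {m N : ℕ} (h : m < N) :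
    PowerSeries.coeff m (y * evalSeries a x) =
      PowerSeries.coeff m (y * (∑ k ∈ Finset.range N, a k • x ^ k)) := by
  rw [PowerSeries.coeff_mul, PowerSeries.coeff_mul]
  refine Finset.sum_congr rfl fun p hp => ?_
  have := Finset.HasAntidiagonal.mem_antidiagonal.1 hp
  rw [coeff_evalSeries a hx (by omega : p.2 < N)]

/-- If `y x = z y` then `y f(x) = f(z) y`. -/
theorem semiconjBy_evalSeries (a : ℕ → ℂ) {x y z : A⟦X⟧}
    (hx : PowerSeries.constantCoeff x = 0) (hz : PowerSeries.constantCoeff z = 0)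
    (h : SemiconjBy y x z) : SemiconjBy y (evalSeries a x) (evalSeries a z) := by
  ext m
  rw [coeff_mul_evalSeries a hx y m.lt_succ_self, coeff_evalSeries_mul a hz y m.lt_succ_self,
    Finset.mul_sum, Finset.sum_mul]
  congr 1
  refine Finset.sum_congr rfl fun k _ => ?_
  rw [mul_smul_comm, smul_mul_assoc, (h.pow_right k).eq]

theorem map_evalSeries {B : Type*} [Ring B] [Algebra ℂ B] (f : A →ₐ[ℂ] B) (a : ℕ → ℂ)
    (x : A⟦X⟧) :
    PowerSeries.mapAlgHom f (evalSeries a x) = evalSeries a (PowerSeries.mapAlgHom f x) := by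
  ext m
  simp only [evalSeries, PowerSeries.mapAlgHom_apply, PowerSeries.coeff_map, PowerSeries.coeff_mk,
    map_sum, ← map_pow]
  simp

theorem constantCoeff_evalSeries (a : ℕ → ℂ) (x : A⟦X⟧) :
    PowerSeries.constantCoeff (evalSeries a x) = a 0 • 1 := by
  rw [← PowerSeries.coeff_zero_eq_constantCoeff_apply]
  simp [evalSeries]

theorem fexp_zero : fexp (0 : A⟦X⟧) = 1 := by
  ext m
  rw [fexp, coeff_evalSeries _ (by simp) m.lt_succ_self, Finset.sum_range_succ']
  simp

theorem fexp_add {x y : A⟦X⟧} (hx : PowerSeries.constantCoeff x = 0)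
    (hy : PowerSeries.constantCoeff y = 0) (h : Commute x y) :
    fexp (x + y) = fexp x * fexp y := by
  ext m
  have hxy : PowerSeries.constantCoeff (x + y) = 0 := by simp [hx, hy]
  rw [fexp, fexp, fexp, coeff_evalSeries_mul _ hx _ m.lt_succ_self,
    coeff_mul_evalSeries _ hy _ m.lt_succ_self, coeff_evalSeries _ hxy m.lt_succ_self,
    Finset.sum_mul_sum, ← Finset.sum_product']
  simp only [map_sum]
  have key : ∀ k, PowerSeries.coeff m ((1 / (k.factorial : ℂ)) • (x + y) ^ k) =
      ∑ p ∈ Finset.HasAntidiagonal.antidiagonal k, PowerSeries.coeff m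
        ((1 / (p.1.factorial : ℂ)) • x ^ p.1 * (1 / (p.2.factorial : ℂ)) • y ^ p.2) := by
    intro k
    rw [h.add_pow', Finset.smul_sum, map_sum]
    refine Finset.sum_congr rfl fun p hp => ?_
    rw [smul_mul_smul_comm, ← Nat.cast_smul_eq_nsmul ℂ, smul_smul]
    congr 2
    rw [← Finset.HasAntidiagonal.mem_antidiagonal.1 hp, Nat.cast_add_choose]
    have := Nat.factorial_ne_zero (p.1 + p.2)
    field_simp
  simp only [key]
  rw [Finset.sum_sigma']
  symm
  -- The product of two truncations runs over a square, the truncation of the binomial expansion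
  -- over a triangle. The pairs outside the triangle have total degree above `m` and contribute
  -- nothing.
  rw [← Finset.sum_filter_add_sum_filter_not _ (fun p : ℕ × ℕ => p.1 + p.2 ≤ m)]
  rw [Finset.sum_eq_zero (s := Finset.filter (fun p : ℕ × ℕ => ¬ p.1 + p.2 ≤ m) _), add_zero]
  · refine Finset.sum_bij' (fun p _ => ⟨p.1 + p.2, p⟩) (fun q _ => q.2) ?_ ?_ ?_ ?_ ?_
    · intro p hp
      simp at hp ⊢
      omega
    · rintro ⟨k, p⟩ hp
      simp at hp ⊢
      omega
    · intros; rfl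
    · rintro ⟨k, p⟩ hp
      simp only [Finset.mem_sigma, Finset.HasAntidiagonal.mem_antidiagonal] at hp
      obtain ⟨_, rfl⟩ := hp
      rfl
    · intros; rfl
  · intro p hp
    simp only [Finset.mem_filter, not_le] at hp
    rw [smul_mul_smul_comm, PowerSeries.coeff_smul, coeff_pow_mul_pow_eq_zero hx hy hp.2,
      smul_zero]

theorem isUnit_fexp {x : A⟦X⟧} (hx : PowerSeries.constantCoeff x = 0) : IsUnit (fexp x) := by
  have hx' : PowerSeries.constantCoeff (-x) = 0 := by simp [hx]
  refine ⟨⟨fexp x, fexp (-x), ?_, ?_⟩, rfl⟩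
  · rw [← fexp_add hx hx' (Commute.neg_right (Commute.refl x)), add_neg_cancel, fexp_zero]
  · rw [← fexp_add hx' hx (Commute.neg_left (Commute.refl x)), neg_add_cancel, fexp_zero]

/-- The product of the exponentials of commuting elements. -/
theorem prod_fexp (l : List A⟦X⟧) (h0 : ∀ x ∈ l, PowerSeries.constantCoeff x = 0)
    (hc : ∀ x ∈ l, ∀ y ∈ l, Commute x y) : (l.map fexp).prod = fexp l.sum := by
  induction l with
  | nil => simp [fexp_zero]
  | cons x l ih =>
    simp only [List.mem_cons, forall_eq_or_imp] at h0 hc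
    have hs : PowerSeries.constantCoeff l.sum = 0 := by
      rw [map_list_sum]
      exact List.sum_eq_zero (by simpa using h0.2)
    have hxs : Commute x l.sum := Commute.list_sum_right x l fun y hy => hc.1.2 y hy
    rw [List.map_cons, List.prod_cons, List.sum_cons, fexp_add h0.1 hs hxs,
      ih h0.2 fun y hy z hz => (hc.2 y hy).2 z hz]

/-- `e^x y e^{-x} = y + z + u` if `[x, y] = z`, `[x, z] = 2 u` and `[x, u] = 0`. -/
theorem semiconjBy_fexp {x y z u : A⟦X⟧} (hx : PowerSeries.constantCoeff x = 0)
    (hy : x * y = y * x + z) (hz : x * z = z * x + (2 : ℂ) • u) (hu : x * u = u * x) :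
    SemiconjBy (fexp x) y (y + z + u) := by
  -- Moving `y` to the left through `x ^ (k + 2)` picks up `z` once for each factor and `2 • u` once
  -- for each pair of factors.
  have key : ∀ k : ℕ, x ^ (k + 2) * y = y * x ^ (k + 2) + (k + 2 : ℂ) • (z * x ^ (k + 1)) +
      ((k + 2) * (k + 1) : ℂ) • (u * x ^ k) := by
    intro k
    induction k with
    | zero =>
      simp only [pow_succ, pow_zero, one_mul, zero_add, mul_assoc, hy, mul_add]
      rw [← mul_assoc x y, hy, hz, add_mul, mul_assoc]
      simp
      module
    | succ k ih =>
      rw [pow_succ' x (k + 2), mul_assoc, ih, mul_add, mul_add, mul_smul_comm, mul_smul_comm,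
        ← mul_assoc, ← mul_assoc, ← mul_assoc, hy, hz, hu, add_mul, add_mul, smul_mul_assoc]
      simp only [mul_assoc, ← pow_succ']
      push_cast
      module
  -- The factors `k + 2` and `(k + 2) * (k + 1)` cancel against the factorial and shift the
  -- exponential series by one and two places, hence the three truncation lengths.
  have sums : ∀ N : ℕ, (∑ k ∈ Finset.range (N + 2), (1 / (k.factorial : ℂ)) • x ^ k) * y =
      y * (∑ k ∈ Finset.range (N + 2), (1 / (k.factorial : ℂ)) • x ^ k) +
      z * (∑ k ∈ Finset.range (N + 1), (1 / (k.factorial : ℂ)) • x ^ k) +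
      u * (∑ k ∈ Finset.range N, (1 / (k.factorial : ℂ)) • x ^ k) := by
    intro N
    induction N with
    | zero =>
      simp [Finset.sum_range_succ, add_mul, mul_add, hy, add_assoc]
    | succ N ih =>
      rw [Finset.sum_range_succ _ (N + 2), Finset.sum_range_succ _ (N + 1),
        Finset.sum_range_succ _ N, add_mul]
      rw [Finset.sum_range_succ _ (N + 1), Finset.sum_range_succ _ N] at ih
      rw [ih, smul_mul_assoc, key]
      have h1 : 1 / ((N + 2).factorial : ℂ) * (N + 2) = 1 / ((N + 1).factorial : ℂ) := by
        rw [Nat.factorial_succ (N + 1)]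
        have : ((N + 1).factorial : ℂ) ≠ 0 := by exact_mod_cast Nat.factorial_ne_zero _
        have : (N + 1 + 1 : ℂ) ≠ 0 := by exact_mod_cast Nat.cast_add_one_ne_zero (R := ℂ) (N + 1)
        push_cast
        field_simp
        ring
      have h2 : 1 / ((N + 2).factorial : ℂ) * ((N + 2) * (N + 1)) = 1 / (N.factorial : ℂ) := by
        rw [← mul_assoc, h1, Nat.factorial_succ N]
        have : (N.factorial : ℂ) ≠ 0 := by exact_mod_cast Nat.factorial_ne_zero _
        have : (N + 1 : ℂ) ≠ 0 := Nat.cast_add_one_ne_zero N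
        push_cast
        field_simp
      simp only [smul_add, smul_smul, h1, h2, mul_add z, mul_add y, mul_add u, mul_smul_comm]
      abel
  ext m
  -- With `N = m + 1` even the shortest of the three truncations still determines the coefficient of
  -- degree `m`.
  rw [fexp, coeff_evalSeries_mul _ hx y (by omega : m < m + 1 + 2), sums, add_mul, add_mul]
  simp only [map_add]
  rw [coeff_mul_evalSeries _ hx y (by omega : m < m + 1 + 2),
    coeff_mul_evalSeries _ hx z (by omega : m < m + 1 + 1),
    coeff_mul_evalSeries _ hx u (by omega : m < m + 1)]

/-! ### Exponentials of logarithms -/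

theorem derivative_fexp (f : ℂ⟦X⟧) (hf : PowerSeries.constantCoeff f = 0) :
    PowerSeries.derivative ℂ (fexp f) = PowerSeries.derivative ℂ f * fexp f := by
  ext m
  rw [PowerSeries.coeff_derivative, fexp, coeff_mul_evalSeries _ hf _ m.lt_succ_self,
    coeff_evalSeries _ hf (m + 1).lt_succ_self, ← PowerSeries.coeff_derivative,
    Finset.sum_range_succ', map_add, map_sum, Finset.mul_sum]
  simp only [map_sum, map_add]
  rw [show PowerSeries.derivative ℂ ((1 / ((0 : ℕ).factorial : ℂ)) • f ^ 0) = 0 by simp,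
    map_zero, add_zero]
  refine Finset.sum_congr rfl fun k _ => ?_
  congr 1
  rw [Derivation.map_smul, Derivation.leibniz_pow]
  have : (k.factorial : ℂ) ≠ 0 := by exact_mod_cast Nat.factorial_ne_zero _
  have : (k + 1 : ℂ) ≠ 0 := Nat.cast_add_one_ne_zero k
  rw [← Nat.cast_smul_eq_nsmul ℂ, smul_smul, Nat.factorial_succ, mul_smul_comm, smul_eq_mul,
    mul_comm (PowerSeries.derivative ℂ f)]
  congr 1
  push_cast
  field_simp

theorem coeff_flog1p_X (m : ℕ) : PowerSeries.coeff m (flog1p (PowerSeries.X : ℂ⟦X⟧)) =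
    if m = 0 then 0 else (-1) ^ (m + 1) / (m : ℂ) := by
  simp only [flog1p, evalSeries, PowerSeries.coeff_mk, PowerSeries.coeff_X_pow, smul_eq_mul]
  rw [Finset.sum_eq_single m]
  · simp
  · intro k _ hk; simp [Ne.symm hk]
  · simp

theorem constantCoeff_flog1p (x : A⟦X⟧) : PowerSeries.constantCoeff (flog1p x) = 0 := by
  simp [flog1p, constantCoeff_evalSeries]

theorem one_add_X_mul_derivative_flog1p_X :
    (1 + PowerSeries.X) * PowerSeries.derivative ℂ (flog1p (PowerSeries.X : ℂ⟦X⟧)) = 1 := by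
  have h : ∀ m, PowerSeries.coeff m
      (PowerSeries.derivative ℂ (flog1p (PowerSeries.X : ℂ⟦X⟧))) = (-1) ^ m := by
    intro m
    rw [PowerSeries.coeff_derivative, coeff_flog1p_X]
    have : (m + 1 : ℂ) ≠ 0 := Nat.cast_add_one_ne_zero m
    simp
    field_simp
    ring
  ext m
  rw [add_mul, one_mul, map_add, h]
  cases m with
  | zero => simp
  | succ m =>
    rw [PowerSeries.coeff_succ_X_mul, h, PowerSeries.coeff_one]
    simp [pow_succ]

/-- The series `g = exp (ln (1 + X))` solves `(1 + X) g' = g` with `g(0) = 1`. Comparing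
coefficients determines `g` recursively: the linear coefficient is 1 and all later ones vanish. -/
theorem fexp_flog1p_X : fexp (flog1p (PowerSeries.X : ℂ⟦X⟧)) = 1 + PowerSeries.X := by
  set g := fexp (flog1p (PowerSeries.X : ℂ⟦X⟧)) with hg
  have hd : (1 + PowerSeries.X) * PowerSeries.derivative ℂ g = g := by
    rw [hg, derivative_fexp _ (constantCoeff_flog1p _), ← mul_assoc,
      one_add_X_mul_derivative_flog1p_X, one_mul]
  have h0 : PowerSeries.coeff 0 g = 1 := by
    rw [PowerSeries.coeff_zero_eq_constantCoeff_apply, hg, fexp, constantCoeff_evalSeries]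
    simp
  have hc := fun m => congrArg (PowerSeries.coeff m) hd
  simp only [add_mul, one_mul, map_add] at hc
  have h1 : PowerSeries.coeff 1 g = 1 := by
    have := hc 0
    rw [PowerSeries.coeff_zero_X_mul, PowerSeries.coeff_derivative, h0] at this
    simpa using this
  have h2 : ∀ m, PowerSeries.coeff (m + 2) g = 0 := by
    intro m
    induction m with
    | zero =>
      have := hc 1
      rw [PowerSeries.coeff_succ_X_mul, PowerSeries.coeff_derivative,
        PowerSeries.coeff_derivative, h1] at this
      norm_num at this
      exact this
    | succ m ih =>
      have := hc (m + 2)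
      rw [PowerSeries.coeff_succ_X_mul, PowerSeries.coeff_derivative,
        PowerSeries.coeff_derivative, ih] at this
      rw [zero_mul, add_zero] at this
      exact (mul_eq_zero.1 this).resolve_right (Nat.cast_add_one_ne_zero (m + 2))
  ext m
  match m with
  | 0 => simpa using h0
  | 1 => simpa [PowerSeries.coeff_one] using h1
  | m + 2 => simpa [PowerSeries.coeff_one, PowerSeries.coeff_X] using h2 m

/-- The substitution `f(X) ↦ f(ξ E)`. -/
noncomputable def substMul (E : A) : ℂ⟦X⟧ →ₐ[ℂ] A⟦X⟧ where
  toFun f := PowerSeries.mk fun k => PowerSeries.coeff k f • E ^ k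
  map_one' := by
    ext m
    by_cases h : m = 0 <;> simp [PowerSeries.coeff_one, h]
  map_mul' f g := by
    ext m
    simp only [PowerSeries.coeff_mk, PowerSeries.coeff_mul, Finset.sum_smul]
    refine Finset.sum_congr rfl fun p hp => ?_
    rw [smul_mul_smul_comm, ← pow_add, Finset.HasAntidiagonal.mem_antidiagonal.1 hp]
  map_zero' := by ext m; simp
  map_add' f g := by ext m; simp [add_smul]
  commutes' c := by
    ext m
    rw [PowerSeries.algebraMap_apply, PowerSeries.algebraMap_apply]
    by_cases h : m = 0 <;> simp [PowerSeries.coeff_C, h, Algebra.algebraMap_eq_smul_one]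

theorem coeff_substMul (E : A) (f : ℂ⟦X⟧) (m : ℕ) :
    PowerSeries.coeff m (substMul E f) = PowerSeries.coeff m f • E ^ m := by
  simp [substMul]

theorem substMul_X (E : A) : substMul E PowerSeries.X = PowerSeries.X * PowerSeries.C E := by
  ext m
  rw [coeff_substMul]
  cases m with
  | zero => simp
  | succ m =>
    rw [PowerSeries.coeff_succ_X_mul, PowerSeries.coeff_X, PowerSeries.coeff_C]
    by_cases h : m = 0 <;> simp [h]

theorem substMul_evalSeries (E : A) (a : ℕ → ℂ) (f : ℂ⟦X⟧) :
    substMul E (evalSeries a f) = evalSeries a (substMul E f) := by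
  ext m
  simp only [coeff_substMul, evalSeries, PowerSeries.coeff_mk, Finset.sum_smul, ← map_pow,
    smul_assoc]

/-- Only powers of the single element `E` occur, so the identity is the image of the scalar one
under the homomorphism `substMul E`. -/
theorem fexp_flog1p (E : A) :
    fexp (flog1p (PowerSeries.X * PowerSeries.C E)) = 1 + PowerSeries.X * PowerSeries.C E := by
  rw [← substMul_X, flog1p, ← substMul_evalSeries, fexp, ← substMul_evalSeries]
  change substMul E (fexp (flog1p PowerSeries.X)) = _
  rw [fexp_flog1p_X, map_add, map_one]

end FormalExp

end SpTwist

namespace SpTwist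

attribute [local instance 100] LieRing.ofAssociativeRing

/-! ### Brackets of root vectors -/

section Brackets

variable {N : ℕ}

theorem Eplus_comm (i j : Fin N) : Eplus i j = Eplus j i := by
  apply Subtype.ext; simp [Eplus, add_comm]

theorem Fplus_comm (i j : Fin N) : Fplus i j = Fplus j i := by
  apply Subtype.ext; simp [Fplus, add_comm]

/-- Allowing `Eminus i i` as a multiple of the Cartan element lets the bracket formulas below hold
for all indices, without separate Cartan cases. -/
theorem Hcartan_eq (i : Fin N) : Hcartan i = (1 / 2 : ℂ) • Eminus i i := by
  apply Subtype.ext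
  simp [Hcartan, Eminus, Matrix.fromBlocks_smul, Matrix.smul_single]

theorem single_mul_single_ite (i j k l : Fin N) :
    (Matrix.single i j (1 : ℂ) * Matrix.single k l 1 : Matrix (Fin N) (Fin N) ℂ) =
      if j = k then Matrix.single i l 1 else 0 := by
  split_ifs with h
  · subst h; simp
  · simp [h]

theorem lie_Eplus_Eplus (i j k l : Fin N) : ⁅Eplus i j, Eplus k l⁆ = 0 := by
  apply Subtype.ext
  simp [Eplus, LieRing.of_associative_ring_bracket, Matrix.fromBlocks_multiply]

theorem lie_Fplus_Fplus (i j k l : Fin N) : ⁅Fplus i j, Fplus k l⁆ = 0 := by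
  apply Subtype.ext
  simp [Fplus, LieRing.of_associative_ring_bracket, Matrix.fromBlocks_multiply]

theorem fromBlocks_sub' (A B C D A' B' C' D' : Matrix (Fin N) (Fin N) ℂ) :
    Matrix.fromBlocks A B C D - Matrix.fromBlocks A' B' C' D' =
      Matrix.fromBlocks (A - A') (B - B') (C - C') (D - D') := by
  simp [sub_eq_add_neg, Matrix.fromBlocks_neg, Matrix.fromBlocks_add]

theorem lie_Eplus_Fplus (i j k l : Fin N) : ⁅Eplus i j, Fplus k l⁆ =
    (if j = k then Eminus i l else 0) + (if j = l then Eminus i k else 0) +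
      (if i = k then Eminus j l else 0) + (if i = l then Eminus j k else 0) := by
  apply Subtype.ext
  simp only [Eplus, Fplus, Eminus, LieRing.of_associative_ring_bracket, LieSubalgebra.coe_bracket,
    Matrix.fromBlocks_multiply, fromBlocks_sub', add_mul, mul_add, single_mul_single_ite,
    AddMemClass.coe_add, apply_ite Subtype.val, ZeroMemClass.coe_zero, Matrix.transpose_zero,
    neg_zero, mul_zero, zero_mul, add_zero, zero_add, sub_zero, zero_sub, Matrix.transpose_single,
    @eq_comm _ k, @eq_comm _ l]
  split_ifs <;>
    simp only [← Matrix.fromBlocks_zero, Matrix.fromBlocks_add, Matrix.fromBlocks_neg,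
      fromBlocks_sub', Matrix.fromBlocks_inj] <;>
    refine ⟨?_, ?_, ?_, ?_⟩ <;> first | trivial | abel

theorem lie_Eminus_Eplus (i j k l : Fin N) : ⁅Eminus i j, Eplus k l⁆ =
    (if j = k then Eplus i l else 0) + (if j = l then Eplus i k else 0) := by
  apply Subtype.ext
  simp only [Eplus, Eminus, LieRing.of_associative_ring_bracket, LieSubalgebra.coe_bracket,
    Matrix.fromBlocks_multiply, fromBlocks_sub', add_mul, mul_add, single_mul_single_ite,
    AddMemClass.coe_add, apply_ite Subtype.val, ZeroMemClass.coe_zero, Matrix.transpose_zero,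
    neg_zero, mul_zero, zero_mul, add_zero, zero_add, sub_zero, zero_sub, Matrix.transpose_single,
    mul_neg, neg_mul, neg_neg, @eq_comm _ k, @eq_comm _ l]
  split_ifs <;>
    simp only [← Matrix.fromBlocks_zero, Matrix.fromBlocks_add, Matrix.fromBlocks_neg,
      fromBlocks_sub', Matrix.fromBlocks_inj] <;>
    refine ⟨?_, ?_, ?_, ?_⟩ <;> first | trivial | abel

theorem lie_Eminus_Fplus (i j k l : Fin N) : ⁅Eminus i j, Fplus k l⁆ =
    - (if i = k then Fplus j l else 0) - (if i = l then Fplus j k else 0) := by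
  apply Subtype.ext
  simp only [Fplus, Eminus, LieRing.of_associative_ring_bracket, LieSubalgebra.coe_bracket,
    Matrix.fromBlocks_multiply, fromBlocks_sub', add_mul, mul_add, single_mul_single_ite,
    AddSubgroupClass.coe_sub, NegMemClass.coe_neg, apply_ite Subtype.val, ZeroMemClass.coe_zero,
    Matrix.transpose_zero,
    neg_zero, mul_zero, zero_mul, add_zero, zero_add, sub_zero, zero_sub, Matrix.transpose_single,
    mul_neg, neg_mul, neg_neg, @eq_comm _ k, @eq_comm _ l]
  split_ifs <;>
    simp only [← Matrix.fromBlocks_zero, Matrix.fromBlocks_add, Matrix.fromBlocks_neg,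
      fromBlocks_sub', Matrix.fromBlocks_inj] <;>
    refine ⟨?_, ?_, ?_, ?_⟩ <;> first | trivial | abel

theorem lie_Eminus_Eminus (i j k l : Fin N) : ⁅Eminus i j, Eminus k l⁆ =
    (if j = k then Eminus i l else 0) - (if i = l then Eminus k j else 0) := by
  apply Subtype.ext
  simp only [Eminus, LieRing.of_associative_ring_bracket, LieSubalgebra.coe_bracket,
    Matrix.fromBlocks_multiply, fromBlocks_sub', add_mul, mul_add, single_mul_single_ite,
    AddSubgroupClass.coe_sub, NegMemClass.coe_neg, apply_ite Subtype.val, ZeroMemClass.coe_zero,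
    Matrix.transpose_zero,
    neg_zero, mul_zero, zero_mul, add_zero, zero_add, sub_zero, zero_sub, Matrix.transpose_single,
    mul_neg, neg_mul, neg_neg, @eq_comm _ k, @eq_comm _ l]
  split_ifs <;>
    simp only [← Matrix.fromBlocks_zero, Matrix.fromBlocks_add, Matrix.fromBlocks_neg,
      fromBlocks_sub', Matrix.fromBlocks_inj] <;>
    refine ⟨?_, ?_, ?_, ?_⟩ <;> first | trivial | abel

end Brackets

/-! ### The universal enveloping algebra -/

/-- The defining matrix representation of `sp(N)` is faithful and factors through `ι`. -/
theorem ι_injective (N : ℕ) :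
    Function.Injective (UniversalEnvelopingAlgebra.ι ℂ : Sp N →ₗ⁅ℂ⁆ U N) := by
  intro x y h
  have := congrArg (UniversalEnvelopingAlgebra.lift ℂ (Sp N).incl) h
  simpa using this

theorem emb_mul_emb {N : ℕ} (x y : Sp N) : emb x * emb y = emb y * emb x + emb ⁅x, y⁆ := by
  simp only [emb, LieHom.map_lie, LieRing.of_associative_ring_bracket, ← map_mul, ← map_add]
  congr 1
  abel

/-- `emb` as a linear map. -/
noncomputable def embₗ (N : ℕ) : Sp N →ₗ[ℂ] (U N)⟦X⟧ where
  toFun := emb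
  map_add' x y := by simp [emb]
  map_smul' c x := by
    ext m
    by_cases h : m = 0 <;> simp [emb, PowerSeries.coeff_C, h]

theorem emb_add {N : ℕ} (x y : Sp N) : emb (x + y) = emb x + emb y := (embₗ N).map_add x y
theorem emb_sub {N : ℕ} (x y : Sp N) : emb (x - y) = emb x - emb y := (embₗ N).map_sub x y
theorem emb_neg {N : ℕ} (x : Sp N) : emb (-x) = -emb x := (embₗ N).map_neg x
theorem emb_zero {N : ℕ} : emb (0 : Sp N) = 0 := (embₗ N).map_zero
theorem emb_smul {N : ℕ} (c : ℂ) (x : Sp N) : emb (c • x) = c • emb x := (embₗ N).map_smul c x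
theorem emb_ite {N : ℕ} (p : Prop) [Decidable p] (x y : Sp N) :
    emb (if p then x else y) = if p then emb x else emb y := apply_ite _ _ _ _

theorem commute_emb {N : ℕ} {x y : Sp N} (h : ⁅x, y⁆ = 0) : Commute (emb x) (emb y) := by
  rw [Commute, SemiconjBy, emb_mul_emb, h, emb_zero, add_zero]

end SpTwist

namespace SpTwist

attribute [local instance 100] LieRing.ofAssociativeRing

/-! ### Commutators in associative rings -/

section Ring

variable {A : Type*} [Ring A]

theorem ring_lie_mul (x y z : A) : ⁅x, y * z⁆ = ⁅x, y⁆ * z + y * ⁅x, z⁆ := by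
  simp only [LieRing.of_associative_ring_bracket]; noncomm_ring

theorem ring_mul_lie (x y z : A) : ⁅x * y, z⁆ = ⁅x, z⁆ * y + x * ⁅y, z⁆ := by
  simp only [LieRing.of_associative_ring_bracket]; noncomm_ring

theorem lie_eq_zero_of_commute {x y : A} (h : Commute x y) : ⁅x, y⁆ = 0 := by
  rw [LieRing.of_associative_ring_bracket, h.eq, sub_self]

theorem commute_of_lie_eq_zero {x y : A} (h : ⁅x, y⁆ = 0) : Commute x y := by
  rwa [LieRing.of_associative_ring_bracket, sub_eq_zero] at h

theorem ξ_mul_lie (x y : A⟦X⟧) : ⁅ξ * x, y⁆ = ξ * ⁅x, y⁆ := by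
  rw [ring_mul_lie, lie_eq_zero_of_commute (PowerSeries.commute_X y).symm, zero_mul, zero_add]

theorem lie_ξ_mul (x y : A⟦X⟧) : ⁅x, ξ * y⁆ = ξ * ⁅x, y⁆ := by
  rw [ring_lie_mul, lie_eq_zero_of_commute (PowerSeries.commute_X x), zero_mul, zero_add]

theorem semiconjBy_fexp_ξ_mul [Algebra ℂ A] {x y z u : A⟦X⟧} (hy : ⁅x, y⁆ = z)
    (hz : ⁅x, z⁆ = (2 : ℂ) • u) (hu : ⁅x, u⁆ = 0) :
    SemiconjBy (fexp (ξ * x)) y (y + ξ * z + ξ ^ 2 * u) := by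
  refine semiconjBy_fexp (by simp) ?_ ?_ ?_
  · rw [← hy, ← ξ_mul_lie, LieRing.of_associative_ring_bracket]; abel
  · rw [← sub_eq_iff_eq_add', ← LieRing.of_associative_ring_bracket, ξ_mul_lie, lie_ξ_mul, hz,
      mul_smul_comm, mul_smul_comm, ← mul_assoc, ← pow_two]
  · rw [← sub_eq_zero, ← LieRing.of_associative_ring_bracket, pow_two, mul_assoc, ξ_mul_lie,
      lie_ξ_mul, lie_ξ_mul, hu]
    simp

theorem commute_fexp_ξ_mul [Algebra ℂ A] {x y : A⟦X⟧} (hy : ⁅x, y⁆ = 0) :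
    SemiconjBy (fexp (ξ * x)) y y := by
  simpa using semiconjBy_fexp_ξ_mul (u := 0) hy (by simp) (by simp)

end Ring

theorem lie_emb {N : ℕ} (x y : Sp N) : ⁅emb x, emb y⁆ = emb ⁅x, y⁆ := by
  rw [LieRing.of_associative_ring_bracket, emb_mul_emb, add_sub_cancel_left]

/-! ### The completed tensor square -/

section Tensor

variable {N : ℕ}

/-- `a ↦ a ⊗ 1`. -/
noncomputable def lft (N : ℕ) : (U N)⟦X⟧ →ₐ[ℂ] (U N ⊗[ℂ] U N)⟦X⟧ :=
  PowerSeries.mapAlgHom Algebra.TensorProduct.includeLeft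

/-- `a ↦ 1 ⊗ a`. -/
noncomputable def rgt (N : ℕ) : (U N)⟦X⟧ →ₐ[ℂ] (U N ⊗[ℂ] U N)⟦X⟧ :=
  PowerSeries.mapAlgHom Algebra.TensorProduct.includeRight

theorem tens_eq (a b : (U N)⟦X⟧) : a ⊠ b = lft N a * rgt N b := rfl

theorem lft_ξ : lft N ξ = ξ := by simp [lft, PowerSeries.mapAlgHom_apply]

theorem rgt_ξ : rgt N ξ = ξ := by simp [rgt, PowerSeries.mapAlgHom_apply]

/-- The two tensor legs commute coefficient by coefficient; exchanging the entries of the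
antidiagonal matches the two Cauchy products. -/
theorem commute_lft_rgt (a b : (U N)⟦X⟧) : Commute (lft N a) (rgt N b) := by
  ext m
  rw [PowerSeries.coeff_mul, PowerSeries.coeff_mul]
  refine Finset.sum_equiv (Equiv.prodComm ℕ ℕ) (by simp [add_comm]) fun p _ => ?_
  simp [lft, rgt, PowerSeries.mapAlgHom_apply]

theorem tens_mul_tens (a b c d : (U N)⟦X⟧) : (a ⊠ b) * (c ⊠ d) = (a * c) ⊠ (b * d) := by
  simp only [tens_eq, map_mul]
  rw [mul_assoc, ← mul_assoc (rgt N b), ← (commute_lft_rgt c b).eq]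
  simp only [mul_assoc]

theorem add_tens (a b c : (U N)⟦X⟧) : (a + b) ⊠ c = a ⊠ c + b ⊠ c := by
  simp [tens_eq, add_mul]

theorem tens_add (a b c : (U N)⟦X⟧) : a ⊠ (b + c) = a ⊠ b + a ⊠ c := by
  simp [tens_eq, mul_add]

theorem tens_neg (a b : (U N)⟦X⟧) : a ⊠ (-b) = -(a ⊠ b) := by simp [tens_eq]
theorem zero_tens (b : (U N)⟦X⟧) : (0 : (U N)⟦X⟧) ⊠ b = 0 := by simp [tens_eq]
theorem tens_zero (b : (U N)⟦X⟧) : b ⊠ (0 : (U N)⟦X⟧) = 0 := by simp [tens_eq]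
theorem sub_tens (a b c : (U N)⟦X⟧) : (a - b) ⊠ c = a ⊠ c - b ⊠ c := by
  simp [tens_eq, sub_mul]
theorem tens_sub (a b c : (U N)⟦X⟧) : a ⊠ (b - c) = a ⊠ b - a ⊠ c := by
  simp [tens_eq, mul_sub]
theorem ξ_mul_tens (a b : (U N)⟦X⟧) : (ξ * a) ⊠ b = ξ * (a ⊠ b) := by
  simp [tens_eq, lft_ξ, mul_assoc]
theorem tens_ξ_mul (a b : (U N)⟦X⟧) : a ⊠ (ξ * b) = ξ * (a ⊠ b) := by
  simp only [tens_eq, map_mul, rgt_ξ, ← mul_assoc]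
  rw [(PowerSeries.commute_X _).eq]
theorem one_tens_one : (1 : (U N)⟦X⟧) ⊠ (1 : (U N)⟦X⟧) = 1 := by simp [tens_eq]

theorem lie_tens_of_commute_right (a b c d : (U N)⟦X⟧) (h : Commute b d) :
    ⁅a ⊠ b, c ⊠ d⁆ = ⁅a, c⁆ ⊠ (b * d) := by
  simp only [LieRing.of_associative_ring_bracket, tens_mul_tens, sub_tens, h.eq]

theorem lie_tens_of_commute_left (a b c d : (U N)⟦X⟧) (h : Commute a c) :
    ⁅a ⊠ b, c ⊠ d⁆ = (a * c) ⊠ ⁅b, d⁆ := by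
  simp only [LieRing.of_associative_ring_bracket, tens_mul_tens, tens_sub, h.eq]

theorem comulξ_emb (x : Sp N) : comulξ N (emb x) = emb x ⊠ 1 + 1 ⊠ emb x := by
  simp [comulξ, emb, tens, PowerSeries.mapAlgHom_apply, comul, primLie]

theorem comulξ_ξ : comulξ N ξ = ξ := by simp [comulξ, PowerSeries.mapAlgHom_apply]

theorem commute_evalSeries {A : Type*} [Ring A] [Algebra ℂ A] (a : ℕ → ℂ) {x y : A⟦X⟧}
    (hx : PowerSeries.constantCoeff x = 0) (h : Commute y x) : Commute y (evalSeries a x) :=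
  semiconjBy_evalSeries a hx hx h

end Tensor

/-! ### The powers of `e^σ` -/

section Sigma

variable {n : ℕ}

theorem constantCoeff_σ : PowerSeries.constantCoeff (σ n) = 0 := constantCoeff_flog1p _

theorem expσ_add (c d : ℂ) : expσ n (c + d) = expσ n c * expσ n d := by
  rw [expσ, add_smul, fexp_add (by simp [constantCoeff_σ]) (by simp [constantCoeff_σ])]
  · rfl
  · exact ((Commute.refl _).smul_left _).smul_right _

theorem expσ_zero : expσ n 0 = 1 := by rw [expσ, zero_smul, fexp_zero]

theorem expσ_one : expσ n 1 = 1 + ξ * E11 n := by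
  rw [expσ, one_smul]; exact fexp_flog1p _

theorem commute_expσ {y : (U (n + 1))⟦X⟧} (h : Commute y (E11 n)) (c : ℂ) :
    Commute y (expσ n c) := by
  refine commute_evalSeries _ (by simp [constantCoeff_σ]) (Commute.smul_right ?_ c)
  exact commute_evalSeries _ (by simp) ((PowerSeries.commute_X y).mul_right h)

theorem commute_emb_σ {x : Sp (n + 1)} (h : ⁅x, (Eplus 0 0 : Sp (n + 1))⁆ = 0) :
    Commute (emb x) (σ n) :=
  commute_evalSeries _ (by simp) ((PowerSeries.commute_X _).mul_right (commute_emb h))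

end Sigma

end SpTwist

namespace SpTwist

attribute [local instance 100] LieRing.ofAssociativeRing

/-! ### Commutators of the carrier of the twist with `sp(N-1)` -/

section Carrier

variable {n : ℕ}

theorem lie_E1m_E1p (i j : Fin n) : ⁅E1m i, E1p j⁆ = if i = j then E11 n else 0 := by
  simp [E1m, E1p, E11, lie_emb, lie_Eminus_Eplus, emb_ite, emb_zero, Fin.succ_ne_zero]

theorem lie_E1m_E1m (i j : Fin n) : ⁅E1m i, E1m j⁆ = 0 := by
  simp [E1m, lie_emb, lie_Eminus_Eminus, emb_zero, Fin.succ_ne_zero, (Fin.succ_ne_zero _).symm]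

theorem lie_E1p_E1p (i j : Fin n) : ⁅E1p i, E1p j⁆ = 0 := by
  simp [E1p, lie_emb, lie_Eplus_Eplus, emb_zero]

theorem lie_E1m_E11 (i : Fin n) : ⁅E1m i, E11 n⁆ = 0 := by
  simp [E1m, E11, lie_emb, lie_Eminus_Eplus, emb_zero, Fin.succ_ne_zero]

theorem lie_E1p_E11 (i : Fin n) : ⁅E1p i, E11 n⁆ = 0 := by
  simp [E1p, E11, lie_emb, lie_Eplus_Eplus, emb_zero]

theorem lie_E1m_Eplus (k i j : Fin n) : ⁅E1m k, emb (Eplus i.succ j.succ)⁆ =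
    (if k = i then E1p j else 0) + (if k = j then E1p i else 0) := by
  simp [E1m, E1p, lie_emb, lie_Eminus_Eplus, emb_add, emb_ite, emb_zero]

theorem lie_E1p_Eplus (k i j : Fin n) : ⁅E1p k, emb (Eplus i.succ j.succ)⁆ = 0 := by
  simp [E1p, lie_emb, lie_Eplus_Eplus, emb_zero]

theorem lie_E11_Eplus (i j : Fin n) : ⁅E11 n, emb (Eplus i.succ j.succ)⁆ = 0 := by
  simp [E11, lie_emb, lie_Eplus_Eplus, emb_zero]

theorem lie_E1m_Fplus (k i j : Fin n) : ⁅E1m k, emb (Fplus i.succ j.succ)⁆ = 0 := by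
  simp [E1m, lie_emb, lie_Eminus_Fplus, emb_zero, (Fin.succ_ne_zero _).symm]

theorem lie_E1p_Fplus (k i j : Fin n) : ⁅E1p k, emb (Fplus i.succ j.succ)⁆ =
    (if k = i then E1m j else 0) + (if k = j then E1m i else 0) := by
  simp [E1m, E1p, lie_emb, lie_Eplus_Fplus, emb_add, emb_ite, emb_zero,
    (Fin.succ_ne_zero _).symm]

theorem lie_E11_Fplus (i j : Fin n) : ⁅E11 n, emb (Fplus i.succ j.succ)⁆ = 0 := by
  simp [E11, lie_emb, lie_Eplus_Fplus, emb_zero, (Fin.succ_ne_zero _).symm]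

theorem lie_E1m_Eminus (k i j : Fin n) : ⁅E1m k, emb (Eminus i.succ j.succ)⁆ =
    if k = i then E1m j else 0 := by
  simp [E1m, lie_emb, lie_Eminus_Eminus, emb_ite, emb_zero, (Fin.succ_ne_zero _).symm]

theorem lie_E1p_Eminus (k i j : Fin n) : ⁅E1p k, emb (Eminus i.succ j.succ)⁆ =
    -if k = j then E1p i else 0 := by
  rw [E1p, lie_emb, ← lie_skew, lie_Eminus_Eplus]
  simp [E1p, emb_neg, emb_ite, emb_zero, Fin.succ_ne_zero, Eplus_comm i.succ, @eq_comm _ j]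

theorem lie_E11_Eminus (i j : Fin n) : ⁅E11 n, emb (Eminus i.succ j.succ)⁆ = 0 := by
  rw [E11, lie_emb, ← lie_skew, lie_Eminus_Eplus]
  simp [emb_zero, Fin.succ_ne_zero]

theorem commute_E1m_expσ (i : Fin n) (c : ℂ) : Commute (E1m i) (expσ n c) :=
  commute_expσ (commute_of_lie_eq_zero (lie_E1m_E11 i)) c

theorem commute_E1p_expσ (i : Fin n) (c : ℂ) : Commute (E1p i) (expσ n c) :=
  commute_expσ (commute_of_lie_eq_zero (lie_E1p_E11 i)) c

theorem commute_Eplus_expσ (i j : Fin n) (c : ℂ) :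
    Commute (emb (Eplus i.succ j.succ)) (expσ n c) :=
  commute_expσ (commute_of_lie_eq_zero (lie_E11_Eplus i j)).symm c

theorem commute_Fplus_expσ (i j : Fin n) (c : ℂ) :
    Commute (emb (Fplus i.succ j.succ)) (expσ n c) :=
  commute_expσ (commute_of_lie_eq_zero (lie_E11_Fplus i j)).symm c

theorem commute_Eminus_expσ (i j : Fin n) (c : ℂ) :
    Commute (emb (Eminus i.succ j.succ)) (expσ n c) :=
  commute_expσ (commute_of_lie_eq_zero (lie_E11_Eminus i j)).symm c

theorem commute_E11_expσ (c : ℂ) : Commute (E11 n) (expσ n c) :=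
  commute_expσ (Commute.refl _) c

end Carrier

/-! ### The jordanian factor -/

section Jordanian

variable {n : ℕ}

theorem constantCoeff_rgt (a : (U (n + 1))⟦X⟧) : PowerSeries.constantCoeff (rgt (n + 1) a) =
    1 ⊗ₜ (PowerSeries.constantCoeff a) := by
  rw [rgt, PowerSeries.mapAlgHom_apply, ← PowerSeries.coeff_zero_eq_constantCoeff_apply,
    PowerSeries.coeff_map, PowerSeries.coeff_zero_eq_constantCoeff_apply]
  rfl

theorem isUnit_ΦJ : IsUnit (ΦJ n) := isUnit_fexp (by
  rw [tens_eq, map_mul, constantCoeff_rgt, constantCoeff_σ]; simp)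

/-- Conjugation by `ΦJ` multiplies an eigenvector of `ad H₁₁` in the first factor by a power of
`e^σ` in the second one. -/
theorem ΦJ_tens_one {x : Sp (n + 1)} {c : ℂ} (h : ⁅(Hcartan 0 : Sp (n + 1)), x⁆ = c • x) :
    SemiconjBy (ΦJ n) (emb x ⊠ 1) (emb x ⊠ expσ n c) := by
  have hσ : PowerSeries.constantCoeff (emb (Hcartan 0) ⊠ σ n) = 0 := by
    rw [tens_eq, map_mul, constantCoeff_rgt, constantCoeff_σ]; simp
  have hcσ : PowerSeries.constantCoeff (rgt (n + 1) (c • σ n)) = 0 := by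
    rw [constantCoeff_rgt]; simp [constantCoeff_σ]
  have hcomm : Commute (rgt (n + 1) (c • σ n)) (emb (Hcartan 0) ⊠ σ n) :=
    (commute_lft_rgt _ _).symm.mul_right
      (((Commute.refl (σ n)).smul_left c).map (rgt (n + 1)))
  -- The weight relation reads H x = x (H + c), so moving `x ⊠ 1` through H ⊗ σ shifts the exponent
  -- by 1 ⊗ cσ. This summand commutes with H ⊗ σ, and its exponential is the factor 1 ⊗ e^{cσ}.
  have key : SemiconjBy (emb x ⊠ 1) (rgt (n + 1) (c • σ n) + emb (Hcartan 0) ⊠ σ n)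
      (emb (Hcartan 0) ⊠ σ n) := by
    rw [SemiconjBy, mul_add, tens_mul_tens, tens_mul_tens, emb_mul_emb (Hcartan 0) x, h, emb_smul,
      add_tens, add_comm (_ * rgt _ _), one_mul, mul_one]
    congr 1
    simp [tens_eq]
  have := semiconjBy_evalSeries (fun k => 1 / (k.factorial : ℂ))
    (by rw [map_add, hσ, hcσ, add_zero])
    hσ key
  change SemiconjBy _ (fexp _) (fexp _) at this
  rw [fexp_add hcσ hσ hcomm] at this
  have hr : rgt (n + 1) (expσ n c) = fexp (rgt (n + 1) (c • σ n)) := map_evalSeries _ _ _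
  rw [SemiconjBy, ΦJ, ← this.eq, ← hr, ← mul_assoc]
  simp [tens_eq]

theorem ΦJ_one_tens {a : (U (n + 1))⟦X⟧} (h : Commute a (σ n)) :
    SemiconjBy (ΦJ n) (1 ⊠ a) (1 ⊠ a) := by
  refine Commute.symm (commute_evalSeries _ ?_ ?_)
  · rw [tens_eq, map_mul, constantCoeff_rgt, constantCoeff_σ]; simp
  · rw [Commute, SemiconjBy, tens_mul_tens, tens_mul_tens, h.eq, one_mul, mul_one]

end Jordanian

/-! ### The extension factor -/

section Extension

variable {n : ℕ}

/-- The exponent of the extension factor is `ξ * extSum`. -/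
noncomputable def extSum (n : ℕ) : (U (n + 1) ⊗[ℂ] U (n + 1))⟦X⟧ :=
  ∑ k : Fin n, E1m k ⊠ (E1p k * expσ n (-1 / 2))

/-- The exponents commute pairwise because their first legs do and their second legs do. The ordered
product is therefore one exponential, and conjugation by it is governed by `ad (extSum n)` alone. -/
theorem ΦE_eq : ΦE n = fexp (ξ * extSum n) := by
  set g : Fin n → (U (n + 1) ⊗[ℂ] U (n + 1))⟦X⟧ :=
    fun i => ξ * (E1m i ⊠ (E1p i * expσ n (-1 / 2))) with hg
  have h := prod_fexp (List.ofFn g).reverse ?_ ?_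
  · rw [List.map_reverse, List.map_ofFn, List.sum_reverse, List.sum_ofFn] at h
    rw [extSum, Finset.mul_sum]
    exact h
  · intro x hx
    simp only [List.mem_reverse, List.mem_ofFn] at hx
    obtain ⟨i, rfl⟩ := hx
    simp [hg]
  · intro x hx y hy
    simp only [List.mem_reverse, List.mem_ofFn] at hx hy
    obtain ⟨i, rfl⟩ := hx
    obtain ⟨j, rfl⟩ := hy
    have hm := commute_of_lie_eq_zero (lie_E1m_E1m i j)
    have hp := commute_of_lie_eq_zero (lie_E1p_E1p i j)
    have : Commute (E1p i * expσ n (-1 / 2)) (E1p j * expσ n (-1 / 2)) :=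
      (hp.mul_right (commute_E1p_expσ _ _)).mul_left
        ((commute_E1p_expσ _ _).symm.mul_right (Commute.refl _))
    apply commute_of_lie_eq_zero
    simp only [hg]
    rw [ξ_mul_lie, lie_ξ_mul, lie_tens_of_commute_left _ _ _ _ hm, lie_eq_zero_of_commute this,
      tens_zero, mul_zero, mul_zero]

theorem isUnit_ΦE : IsUnit (ΦE n) := by
  rw [ΦE_eq]; exact isUnit_fexp (by simp)

/-- When the second legs commute, only the first legs contribute to the bracket. This lemma and its
mirror image below evaluate every application of `ad (extSum n)`. -/
theorem extSum_lie_of_commute_right (u v : (U (n + 1))⟦X⟧) (hv : Commute v (E11 n))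
    (h : ∀ k, Commute (E1p k) v) :
    ⁅extSum n, u ⊠ v⁆ = ∑ k, ⁅E1m k, u⁆ ⊠ (E1p k * v * expσ n (-1 / 2)) := by
  rw [extSum, LieRing.of_associative_ring_bracket, Finset.sum_mul, Finset.mul_sum,
    ← Finset.sum_sub_distrib]
  refine Finset.sum_congr rfl fun k _ => ?_
  rw [← LieRing.of_associative_ring_bracket, lie_tens_of_commute_right, mul_assoc, mul_assoc,
    (commute_expσ hv _).eq]
  exact (h k).mul_left (commute_expσ hv _).symm

theorem extSum_lie_of_commute_left (u v : (U (n + 1))⟦X⟧) (hv : Commute v (E11 n))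
    (h : ∀ k, Commute (E1m k) u) :
    ⁅extSum n, u ⊠ v⁆ = ∑ k, (E1m k * u) ⊠ (⁅E1p k, v⁆ * expσ n (-1 / 2)) := by
  rw [extSum, LieRing.of_associative_ring_bracket, Finset.sum_mul, Finset.mul_sum,
    ← Finset.sum_sub_distrib]
  refine Finset.sum_congr rfl fun k _ => ?_
  rw [← LieRing.of_associative_ring_bracket, lie_tens_of_commute_left _ _ _ _ (h k), ring_mul_lie,
    lie_eq_zero_of_commute (commute_expσ hv _).symm, mul_zero, add_zero]

end Extension

end SpTwist

namespace SpTwist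

attribute [local instance 100] LieRing.ofAssociativeRing

/-! ### Conjugation by the extension factor -/

section ExtensionConj

variable {n : ℕ}

theorem ite_tens (p : Prop) [Decidable p] (a b : (U (n + 1))⟦X⟧) :
    (if p then a else 0) ⊠ b = if p then a ⊠ b else 0 := by
  split_ifs
  · rfl
  · exact zero_tens b

theorem tens_ite (p : Prop) [Decidable p] (a b : (U (n + 1))⟦X⟧) :
    a ⊠ (if p then b else 0) = if p then a ⊠ b else 0 := by
  split_ifs
  · rfl
  · exact tens_zero a

theorem lie_one {A : Type*} [Ring A] (x : A) : ⁅x, (1 : A)⁆ = 0 :=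
  lie_eq_zero_of_commute (Commute.one_right x)

theorem expσ_neg_half_mul_self : expσ n (-1 / 2) * expσ n (-1 / 2) = expσ n (-1) := by
  rw [← expσ_add]; norm_num

theorem expσ_half_mul_neg_half : expσ n (1 / 2) * expσ n (-1 / 2) = 1 := by
  rw [← expσ_add, ← expσ_zero]; norm_num

theorem commute_E1p_E1p (i j : Fin n) : Commute (E1p i) (E1p j) :=
  commute_of_lie_eq_zero (lie_E1p_E1p i j)

theorem commute_E1m_E1m (i j : Fin n) : Commute (E1m i) (E1m j) :=
  commute_of_lie_eq_zero (lie_E1m_E1m i j)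

theorem commute_E1p_E11 (i : Fin n) : Commute (E1p i) (E11 n) :=
  commute_of_lie_eq_zero (lie_E1p_E11 i)

theorem commute_E1m_E11 (i : Fin n) : Commute (E1m i) (E11 n) :=
  commute_of_lie_eq_zero (lie_E1m_E11 i)

theorem commute_expσ_E11 (c : ℂ) : Commute (expσ n c) (E11 n) := (commute_E11_expσ c).symm

theorem expσ_one_tens (u : (U (n + 1))⟦X⟧) :
    expσ n 1 ⊠ u = 1 ⊠ u + ξ * (E11 n ⊠ u) := by
  rw [expσ_one, add_tens, ξ_mul_tens]

theorem E1p_eq (i : Fin n) : E1p i = emb (Eplus 0 i.succ) := rfl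
theorem E1m_eq (i : Fin n) : E1m i = emb (Eminus 0 i.succ) := rfl
theorem E11_eq : E11 n = emb (Eplus 0 0) := rfl

end ExtensionConj

attribute [local irreducible] expσ tens emb E1p E1m E11

section ExtensionConj

variable {n : ℕ}

/-- The first bracket replaces E_{i+j} in the first leg by E_{1+i} or E_{1+j}. The second turns that
into E_{1+1}, the same term from both summands, which is the 2 that `semiconjBy_fexp` divides out.
The third vanishes since E_{1-k} commutes with E_{1+1}. -/
theorem ΦE_Eplus (i j : Fin n) : SemiconjBy (ΦE n)
    (emb (Eplus i.succ j.succ) ⊠ 1 + 1 ⊠ emb (Eplus i.succ j.succ))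
    (emb (Eplus i.succ j.succ) ⊠ 1 + 1 ⊠ emb (Eplus i.succ j.succ)
      + ξ * (E1p i ⊠ (E1p j * expσ n (-1 / 2)) + E1p j ⊠ (E1p i * expσ n (-1 / 2)))
      + ξ ^ 2 * (E11 n ⊠ (E1p i * E1p j * expσ n (-1)))) := by
  have h2 : ∀ a b : Fin n, ⁅extSum n, E1p a ⊠ (E1p b * expσ n (-1 / 2))⁆ =
      E11 n ⊠ (E1p a * E1p b * expσ n (-1)) := by
    intro a b
    rw [extSum_lie_of_commute_right _ _ ((commute_E1p_E11 b).mul_left (commute_expσ_E11 _))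
      fun k => (commute_E1p_E1p k b).mul_right (commute_E1p_expσ k _)]
    simp only [lie_E1m_E1p, ite_tens, Finset.sum_ite_eq', Finset.mem_univ, if_true, mul_assoc,
      expσ_neg_half_mul_self]
  rw [ΦE_eq]
  refine semiconjBy_fexp_ξ_mul ?_ ?_ ?_
  · rw [lie_add, extSum_lie_of_commute_right _ _ (Commute.one_left _) fun k => Commute.one_right _,
      extSum_lie_of_commute_right _ _ (commute_of_lie_eq_zero (lie_E11_Eplus i j)).symm
        fun k => commute_of_lie_eq_zero (lie_E1p_Eplus k i j)]
    simp [lie_E1m_Eplus, lie_one, zero_tens, add_tens, ite_tens, Finset.sum_add_distrib, add_comm]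
  · rw [lie_add, h2, h2, (commute_E1p_E1p j i).eq, two_smul]
  · rw [extSum_lie_of_commute_right]
    · simp [lie_E1m_E11, zero_tens]
    · exact ((commute_E1p_E11 i).mul_left (commute_E1p_E11 j)).mul_left (commute_expσ_E11 _)
    · exact fun k => ((commute_E1p_E1p k i).mul_right (commute_E1p_E1p k j)).mul_right
        (commute_E1p_expσ k _)

/-- Here the brackets act in the second leg, since E_{1-k} commutes with F_{i+j}. The minus sign is
that of [E_{1+k}, E_{1-k}] = -E_{1+1}. -/
theorem ΦE_Fplus (i j : Fin n) : SemiconjBy (ΦE n)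
    (emb (Fplus i.succ j.succ) ⊠ 1 + 1 ⊠ emb (Fplus i.succ j.succ))
    (emb (Fplus i.succ j.succ) ⊠ 1 + 1 ⊠ emb (Fplus i.succ j.succ)
      + ξ * (E1m i ⊠ (E1m j * expσ n (-1 / 2)) + E1m j ⊠ (E1m i * expσ n (-1 / 2)))
      + ξ ^ 2 * -((E1m i * E1m j) ⊠ (E11 n * expσ n (-1)))) := by
  have h2 : ∀ a b : Fin n, ⁅extSum n, E1m a ⊠ (E1m b * expσ n (-1 / 2))⁆ =
      -((E1m b * E1m a) ⊠ (E11 n * expσ n (-1))) := by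
    intro a b
    rw [extSum_lie_of_commute_left _ _ ((commute_E1m_E11 b).mul_left (commute_expσ_E11 _))
      fun k => commute_E1m_E1m k a]
    have : ∀ k, ⁅E1p k, E1m b * expσ n (-1 / 2)⁆ * expσ n (-1 / 2) =
        -if b = k then E11 n * expσ n (-1) else 0 := by
      intro k
      rw [ring_lie_mul, lie_eq_zero_of_commute (commute_E1p_expσ k _), mul_zero, add_zero,
        ← lie_skew, lie_E1m_E1p, mul_assoc, expσ_neg_half_mul_self]
      split_ifs <;> simp
    simp [this, tens_neg, tens_ite]
  rw [ΦE_eq]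
  refine semiconjBy_fexp_ξ_mul ?_ ?_ ?_
  · rw [lie_add, extSum_lie_of_commute_left _ _ (Commute.one_left _)
        fun k => commute_of_lie_eq_zero (lie_E1m_Fplus k i j),
      extSum_lie_of_commute_left _ _ (commute_of_lie_eq_zero (lie_E11_Fplus i j)).symm
        fun k => Commute.one_right _]
    simp [lie_E1p_Fplus, lie_one, tens_zero, tens_add, tens_ite, Finset.sum_add_distrib, add_mul]
  · rw [lie_add, h2, h2, (commute_E1m_E1m j i).eq, two_smul]
  · rw [lie_neg, extSum_lie_of_commute_left]
    · have : ∀ k, ⁅E1p k, E11 n * expσ n (-1)⁆ = 0 := fun k =>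
        lie_eq_zero_of_commute ((commute_E1p_E11 k).mul_right (commute_E1p_expσ k _))
      simp [this, tens_zero]
    · exact (Commute.refl _).mul_left (commute_expσ_E11 _)
    · exact fun k => (commute_E1m_E1m k i).mul_right (commute_E1m_E1m k j)

/-- The E_{1-k} and the E_{1+k} transform dually under the E_{i-j}, so the contributions of the two
legs cancel. The case `i = j` covers the Cartan elements. -/
theorem ΦE_Eminus (i j : Fin n) : SemiconjBy (ΦE n)
    (emb (Eminus i.succ j.succ) ⊠ 1 + 1 ⊠ emb (Eminus i.succ j.succ))
    (emb (Eminus i.succ j.succ) ⊠ 1 + 1 ⊠ emb (Eminus i.succ j.succ)) := by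
  rw [ΦE_eq]
  refine commute_fexp_ξ_mul ?_
  have hE := (commute_of_lie_eq_zero (lie_E11_Eminus i j)).symm
  rw [lie_add, extSum_lie_of_commute_right _ _ (Commute.one_left _) fun k => Commute.one_right _,
    extSum_lie_of_commute_left _ _ hE fun k => Commute.one_right _]
  simp [lie_E1m_Eminus, lie_E1p_Eminus, ite_tens, tens_ite, tens_neg]

theorem ΦE_E1p (i : Fin n) : SemiconjBy (ΦE n) (E1p i ⊠ expσ n (1 / 2) + 1 ⊠ E1p i)
    (E1p i ⊠ expσ n (1 / 2) + expσ n 1 ⊠ E1p i) := by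
  have h : SemiconjBy (fexp (ξ * extSum n)) (E1p i ⊠ expσ n (1 / 2) + 1 ⊠ E1p i)
      (E1p i ⊠ expσ n (1 / 2) + 1 ⊠ E1p i + ξ * (E11 n ⊠ E1p i) + ξ ^ 2 * 0) := by
    refine semiconjBy_fexp_ξ_mul ?_ ?_ (lie_zero _)
    · rw [lie_add, extSum_lie_of_commute_right _ _ (commute_expσ_E11 _)
          fun k => commute_E1p_expσ k _,
        extSum_lie_of_commute_right _ _ (commute_E1p_E11 i) fun k => commute_E1p_E1p k i]
      simp only [lie_E1m_E1p, lie_one, zero_tens, ite_tens, mul_assoc, expσ_half_mul_neg_half,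
        Finset.sum_ite_eq', Finset.mem_univ, if_true, mul_one, Finset.sum_const_zero, add_zero]
    · rw [extSum_lie_of_commute_right _ _ (commute_E1p_E11 i) fun k => commute_E1p_E1p k i]
      simp [lie_E1m_E11, zero_tens]
  rw [expσ_one_tens, ← add_assoc, ΦE_eq]
  simpa only [mul_zero, add_zero] using h

theorem ΦE_E1m (i : Fin n) : SemiconjBy (ΦE n) (E1m i ⊠ expσ n (1 / 2) + 1 ⊠ E1m i)
    (E1m i ⊠ expσ n (-1 / 2) + 1 ⊠ E1m i) := by
  have h1 : SemiconjBy (fexp (ξ * extSum n)) (E1m i ⊠ expσ n (1 / 2) + 1 ⊠ E1m i)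
      (E1m i ⊠ expσ n (1 / 2) + 1 ⊠ E1m i + ξ * -(E1m i ⊠ (E11 n * expσ n (-1 / 2)))
        + ξ ^ 2 * 0) := by
    refine semiconjBy_fexp_ξ_mul ?_ ?_ (lie_zero _)
    · rw [lie_add, extSum_lie_of_commute_right _ _ (commute_expσ_E11 _)
          fun k => commute_E1p_expσ k _,
        extSum_lie_of_commute_left _ _ (commute_E1m_E11 i) fun k => Commute.one_right _]
      have : ∀ k, ⁅E1p k, E1m i⁆ = -if i = k then E11 n else 0 := fun k => by
        rw [← lie_skew, lie_E1m_E1p]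
      simp [lie_E1m_E1m, this, zero_tens, tens_ite, tens_neg]
    · rw [lie_neg, extSum_lie_of_commute_right _ _
        ((Commute.refl _).mul_left (commute_expσ_E11 _))
        fun k => (commute_E1p_E11 k).mul_right (commute_E1p_expσ k _)]
      simp [lie_E1m_E1m, zero_tens]
  -- This is e^σ = 1 + ξ E_{1+1} multiplied by e^{-σ/2}; it absorbs the bracket term and changes
  -- e^{σ/2} into e^{-σ/2}.
  have h2 : expσ n (1 / 2) = expσ n (-1 / 2) + ξ * (E11 n * expσ n (-1 / 2)) := by
    rw [← mul_assoc, ← one_add_mul, ← expσ_one, ← expσ_add]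
    norm_num
  rw [← ΦE_eq] at h1
  convert h1 using 1
  rw [h2, tens_add, tens_ξ_mul]
  simp
  abel

theorem ΦE_expσ_one : SemiconjBy (ΦE n) (expσ n 1 ⊠ expσ n 1) (expσ n 1 ⊠ expσ n 1) := by
  rw [ΦE_eq]
  refine commute_fexp_ξ_mul ?_
  rw [extSum_lie_of_commute_right _ _ (commute_expσ_E11 _) fun k => commute_E1p_expσ k _]
  simp [lie_eq_zero_of_commute (commute_E1m_expσ _ _), zero_tens]

end ExtensionConj

/-! ### The twisted coproduct -/

section TwistedCoproduct

variable {n : ℕ}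

theorem isUnit_twist : IsUnit (twist n) := isUnit_ΦE.mul isUnit_ΦJ

theorem comulTw_eq {a : (U (n + 1))⟦X⟧} {z : (U (n + 1) ⊗[ℂ] U (n + 1))⟦X⟧}
    (h : SemiconjBy (twist n) (comulξ (n + 1) a) z) : comulTw n a = z := by
  rw [comulTw, h.eq, mul_assoc, Ring.mul_inverse_cancel _ isUnit_twist, mul_one]

theorem semiconjBy_twist (a : (U (n + 1))⟦X⟧) :
    SemiconjBy (twist n) (comulξ (n + 1) a) (comulTw n a) := by
  rw [SemiconjBy, comulTw, mul_assoc _ _ (twist n), Ring.inverse_mul_cancel _ isUnit_twist,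
    mul_one]

theorem comulTw_sub (a b : (U (n + 1))⟦X⟧) : comulTw n (a - b) = comulTw n a - comulTw n b := by
  simp only [comulTw, map_sub, mul_sub, sub_mul]

theorem comulTw_smul (c : ℂ) (a : (U (n + 1))⟦X⟧) : comulTw n (c • a) = c • comulTw n a := by
  simp only [comulTw, map_smul, mul_smul_comm, smul_mul_assoc]

theorem comulTw_mul (a b : (U (n + 1))⟦X⟧) : comulTw n (a * b) = comulTw n a * comulTw n b := by
  apply comulTw_eq
  rw [map_mul]
  exact (semiconjBy_twist a).mul_right (semiconjBy_twist b)

theorem comulTw_ξ_mul (a : (U (n + 1))⟦X⟧) : comulTw n (ξ * a) = ξ * comulTw n a := by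
  rw [comulTw_mul]
  congr 1
  apply comulTw_eq
  rw [comulξ_ξ]
  exact PowerSeries.commute_X _

/-- The jordanian factor only inserts e^{cσ} next to `x ⊗ 1`, so what remains is conjugation by
`ΦE`. -/
theorem twist_emb {x : Sp (n + 1)} {c : ℂ} {z : (U (n + 1) ⊗[ℂ] U (n + 1))⟦X⟧}
    (h : ⁅(Hcartan 0 : Sp (n + 1)), x⁆ = c • x) (h' : ⁅x, (Eplus 0 0 : Sp (n + 1))⁆ = 0)
    (hz : SemiconjBy (ΦE n) (emb x ⊠ expσ n c + 1 ⊠ emb x) z) : comulTw n (emb x) = z := by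
  apply comulTw_eq
  rw [comulξ_emb]
  exact hz.mul_left ((ΦJ_tens_one h).add_right (ΦJ_one_tens (commute_emb_σ h')))

theorem comulTw_Eplus (i j : Fin n) : comulTw n (emb (Eplus i.succ j.succ)) =
    emb (Eplus i.succ j.succ) ⊠ 1 + 1 ⊠ emb (Eplus i.succ j.succ)
      + ξ * (E1p i ⊠ (E1p j * expσ n (-1 / 2)) + E1p j ⊠ (E1p i * expσ n (-1 / 2)))
      + ξ ^ 2 * (E11 n ⊠ (E1p i * E1p j * expσ n (-1))) := by
  refine twist_emb (c := 0) ?_ ?_ ?_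
  · simp [Hcartan_eq, lie_Eminus_Eplus, (Fin.succ_ne_zero _).symm]
  · simp [lie_Eplus_Eplus]
  · rw [expσ_zero]; exact ΦE_Eplus i j

theorem comulTw_Fplus (i j : Fin n) : comulTw n (emb (Fplus i.succ j.succ)) =
    emb (Fplus i.succ j.succ) ⊠ 1 + 1 ⊠ emb (Fplus i.succ j.succ)
      + ξ * (E1m i ⊠ (E1m j * expσ n (-1 / 2)) + E1m j ⊠ (E1m i * expσ n (-1 / 2)))
      + ξ ^ 2 * -((E1m i * E1m j) ⊠ (E11 n * expσ n (-1))) := by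
  refine twist_emb (c := 0) ?_ ?_ ?_
  · simp [Hcartan_eq, lie_Eminus_Fplus, (Fin.succ_ne_zero _).symm]
  · rw [← lie_skew]; simp [lie_Eplus_Fplus, (Fin.succ_ne_zero _).symm]
  · rw [expσ_zero]; exact ΦE_Fplus i j

theorem isPrim_Eminus (i j : Fin n) : IsPrim (n := n) (emb (Eminus i.succ j.succ)) := by
  refine twist_emb (c := 0) ?_ ?_ ?_
  · simp [Hcartan_eq, lie_Eminus_Eminus, (Fin.succ_ne_zero _).symm, Fin.succ_ne_zero]
  · simp [lie_Eminus_Eplus, Fin.succ_ne_zero]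
  · rw [expσ_zero]; exact ΦE_Eminus i j

theorem isPrim_Hcartan (i : Fin n) : IsPrim (n := n) (emb (Hcartan i.succ)) := by
  have h := isPrim_Eminus i i
  rw [IsPrim] at h ⊢
  rw [Hcartan_eq, emb_smul, comulTw_smul, h]
  simp [tens_eq]

theorem comulTw_E1p (i : Fin n) :
    comulTw n (E1p i) = E1p i ⊠ expσ n (1 / 2) + expσ n 1 ⊠ E1p i := by
  rw [E1p_eq]
  refine twist_emb ?_ ?_ (by rw [← E1p_eq]; exact ΦE_E1p i)
  · simp [Hcartan_eq, lie_Eminus_Eplus, (Fin.succ_ne_zero _).symm]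
  · simp [lie_Eplus_Eplus]

theorem comulTw_E1m (i : Fin n) :
    comulTw n (E1m i) = E1m i ⊠ expσ n (-1 / 2) + 1 ⊠ E1m i := by
  rw [E1m_eq]
  refine twist_emb ?_ ?_ (by rw [← E1m_eq]; exact ΦE_E1m i)
  · simp [Hcartan_eq, lie_Eminus_Eminus, (Fin.succ_ne_zero _).symm]
  · simp [lie_Eminus_Eplus, Fin.succ_ne_zero]

theorem comulTw_expσ_one : comulTw n (expσ n 1) = expσ n 1 ⊠ expσ n 1 := by
  apply comulTw_eq
  refine ΦE_expσ_one.mul_left ?_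
  have h1 : comulξ (n + 1) (expσ n 1) = 1 + ξ * (E11 n ⊠ 1 + 1 ⊠ E11 n) := by
    rw [expσ_one, map_add, map_one, map_mul, comulξ_ξ, E11_eq, comulξ_emb]
  -- In this form e^σ ⊗ e^σ differs from the untwisted coproduct of e^σ only by E_{1+1} ⊗ e^σ in
  -- place of E_{1+1} ⊗ 1, which is the effect of `ΦJ` at weight 1.
  have h2 : expσ n 1 ⊠ expσ n 1 = 1 + ξ * (E11 n ⊠ expσ n 1 + 1 ⊠ E11 n) := by
    conv_lhs => rw [expσ_one, add_tens, ← expσ_one, ξ_mul_tens]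
    conv_lhs => enter [1]; rw [expσ_one, tens_add, tens_ξ_mul, one_tens_one]
    rw [mul_add]
    abel
  rw [h1, h2]
  have hξ : SemiconjBy (ΦJ n) ξ ξ := PowerSeries.commute_X _
  refine (SemiconjBy.one_right _).add_right (hξ.mul_right (SemiconjBy.add_right ?_ ?_))
    <;> rw [E11_eq]
  · refine ΦJ_tens_one ?_
    simp [Hcartan_eq, lie_Eminus_Eplus]
    module
  · exact ΦJ_one_tens (commute_emb_σ (lie_Eplus_Eplus _ _ _ _))

theorem comulTw_expσ_neg_one : comulTw n (expσ n (-1)) = expσ n (-1) ⊠ expσ n (-1) := by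
  have h1 : expσ n 1 * expσ n (-1) = 1 := by rw [← expσ_add, ← expσ_zero]; norm_num
  have h2 : expσ n (-1) * expσ n 1 = 1 := by rw [← expσ_add, ← expσ_zero]; norm_num
  have h3 : comulTw n (expσ n 1) * comulTw n (expσ n (-1)) = 1 := by
    rw [← comulTw_mul, h1]
    exact comulTw_eq (by rw [map_one]; exact SemiconjBy.one_right _)
  have h4 : (expσ n (-1) ⊠ expσ n (-1)) * comulTw n (expσ n 1) = 1 := by
    rw [comulTw_expσ_one, tens_mul_tens, h2, one_tens_one]
  exact (left_inv_eq_right_inv h4 h3).symm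

theorem isPrim_Fplus' (i j : Fin n) :
    IsPrim (emb (Fplus i.succ j.succ) - ξ * (E1m i * E1m j)) := by
  have hc : expσ n (-1 / 2) * E1m j = E1m j * expσ n (-1 / 2) := (commute_E1m_expσ j _).symm.eq
  have h1 : (1 : (U (n + 1))⟦X⟧) = expσ n (-1) + ξ * (E11 n * expσ n (-1)) := by
    rw [← mul_assoc, ← one_add_mul, ← expσ_one, ← expσ_add, ← expσ_zero]
    norm_num
  -- The square term of the product carries e^{-σ} in its second leg where primitivity needs 1; the
  -- difference is the ξ² term of F_{i+j}.
  have h2 : (E1m i * E1m j) ⊠ 1 = (E1m i * E1m j) ⊠ expσ n (-1) +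
      ξ * ((E1m i * E1m j) ⊠ (E11 n * expσ n (-1))) := by
    conv_lhs => rw [h1, tens_add, tens_ξ_mul]
  rw [IsPrim, comulTw_sub, comulTw_ξ_mul, comulTw_mul, comulTw_E1m, comulTw_E1m, comulTw_Fplus,
    sub_tens, tens_sub, ξ_mul_tens, tens_ξ_mul, h2]
  simp only [mul_add, add_mul, tens_mul_tens, one_mul, mul_one, expσ_neg_half_mul_self, hc,
    mul_neg, pow_two, mul_assoc]
  abel

/-- The factor e^{-σ} turns the outer terms' e^σ ⊗ and ⊗ e^σ excesses into 1 in the first term and a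
single e^σ in the last. Expanding the latter as 1 + ξ E_{1+1} gives the ξ² term of E_{i+j}. -/
theorem comulTw_E1p_mul_E1p (i j : Fin n) : comulTw n (E1p i * E1p j * expσ n (-1)) =
    (E1p i * E1p j * expσ n (-1)) ⊠ 1 + E1p i ⊠ (E1p j * expσ n (-1 / 2)) +
      E1p j ⊠ (E1p i * expσ n (-1 / 2)) + expσ n 1 ⊠ (E1p i * E1p j * expσ n (-1)) := by
  have h0 : expσ n 1 * expσ n (-1) = 1 := by rw [← expσ_add, ← expσ_zero]; norm_num
  have h1 : expσ n (1 / 2) * expσ n (-1) = expσ n (-1 / 2) := by rw [← expσ_add]; norm_num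
  have hp : expσ n (1 / 2) * expσ n (1 / 2) = expσ n 1 := by rw [← expσ_add]; norm_num
  have hc : ∀ c, expσ n c * E1p j = E1p j * expσ n c := fun c => (commute_E1p_expσ j c).symm.eq
  have e1 : expσ n (1 / 2) * expσ n (1 / 2) * expσ n (-1) = 1 := by rw [hp, h0]
  have e2 : E1p i * expσ n 1 * expσ n (-1) = E1p i := by rw [mul_assoc, h0, mul_one]
  have e3 : expσ n (1 / 2) * E1p j * expσ n (-1) = E1p j * expσ n (-1 / 2) := by
    rw [hc, mul_assoc, h1]
  have e4 : expσ n 1 * E1p j * expσ n (-1) = E1p j := by rw [hc, mul_assoc, h0, mul_one]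
  have e5 : E1p i * expσ n (1 / 2) * expσ n (-1) = E1p i * expσ n (-1 / 2) := by
    rw [mul_assoc, h1]
  have e6 : expσ n 1 * expσ n 1 * expσ n (-1) = expσ n 1 := by rw [mul_assoc, h0, mul_one]
  rw [comulTw_mul, comulTw_mul, comulTw_E1p, comulTw_E1p, comulTw_expσ_neg_one]
  simp only [add_mul, mul_add, tens_mul_tens]
  rw [e1, e2, e3, e4, e5, e6]
  abel

theorem isPrim_Eplus' (i j : Fin n) :
    IsPrim (emb (Eplus i.succ j.succ) - ξ * (E1p i * E1p j * expσ n (-1))) := by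
  rw [IsPrim, comulTw_sub, comulTw_ξ_mul, comulTw_E1p_mul_E1p, comulTw_Eplus, expσ_one_tens,
    sub_tens,
    tens_sub, ξ_mul_tens, tens_ξ_mul]
  simp only [mul_add, pow_two]
  rw [mul_assoc ξ ξ]
  abel

theorem isPrim_gen' (g : Gen n) : IsPrim (gen' g) := by
  cases g with
  | Ep i j h => exact isPrim_Eplus' i j
  | Fp i j h => exact isPrim_Fplus' i j
  | Em i j h => exact isPrim_Eminus i j
  | Fm i j h => exact isPrim_Eminus j i
  | H i => exact isPrim_Hcartan i

end TwistedCoproduct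

end SpTwist

namespace SpTwist

attribute [local instance 100] LieRing.ofAssociativeRing

/-! ### The standard basis of `sp(n)` -/

section Basis

variable {n : ℕ}

-- The halves compensate for the sum over ordered pairs: off the diagonal each root vector is
-- counted twice, and on the diagonal its matrix entry is 2.
theorem sp_eq_sum (M : Sp n) : M =
    ∑ i, ∑ j, ((M.1 (.inl i) (.inr j) / 2) • Eplus i j +
      (M.1 (.inr i) (.inl j) / 2) • Fplus i j + M.1 (.inl i) (.inl j) • Eminus i j) := by
  obtain ⟨M, hM⟩ := M
  have h := hM
  rw [Sp, LieAlgebra.Symplectic.sp, mem_skewAdjointMatricesLieSubalgebra,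
    mem_skewAdjointMatricesSubmodule] at h
  rw [← Matrix.fromBlocks_toBlocks M] at h
  simp only [Matrix.IsSkewAdjoint, Matrix.IsAdjointPair, Matrix.J, Matrix.fromBlocks_transpose,
    Matrix.fromBlocks_multiply, Matrix.fromBlocks_neg, Matrix.fromBlocks_inj] at h
  simp only [mul_zero, mul_one, mul_neg, zero_add, add_zero, neg_zero, zero_mul, neg_mul, one_mul,
    neg_neg, neg_inj] at h
  obtain ⟨hC, hA, hD, hB⟩ := h
  have hC' : ∀ i j, M (.inr j) (.inl i) = M (.inr i) (.inl j) := fun i j => congr_fun₂ hC i j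
  have hB' : ∀ i j, M (.inl j) (.inr i) = M (.inl i) (.inr j) := fun i j =>
    congr_fun₂ hB i j
  have hD' : ∀ i j, M (.inr i) (.inr j) = - M (.inl j) (.inl i) := fun i j =>
    (congr_fun₂ hA i j).symm
  apply Subtype.ext
  ext a b
  simp only [AddSubmonoidClass.coe_finsetSum, AddMemClass.coe_add, SetLike.val_smul, Eplus, Fplus,
    Eminus, Matrix.sum_apply, Matrix.add_apply, Matrix.smul_apply]
  rcases a with a | a <;> rcases b with b | b
  · simp [Matrix.single_apply, ite_and]
  · simp [Matrix.single_apply, ite_and, mul_add, Finset.sum_add_distrib, hB' a b]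
  · simp [Matrix.single_apply, ite_and, mul_add, Finset.sum_add_distrib, hC' a b]
  · simp [Matrix.single_apply, ite_and, hD' a b]

theorem sp_induction {p : Sp n → Prop} (hE : ∀ i j, p (Eplus i j)) (hF : ∀ i j, p (Fplus i j))
    (hM : ∀ i j, p (Eminus i j)) (h0 : p 0) (hadd : ∀ x y, p x → p y → p (x + y))
    (hsmul : ∀ (c : ℂ) x, p x → p (c • x)) (x : Sp n) : p x := by
  rw [sp_eq_sum x]
  refine Finset.sum_induction _ p hadd h0 fun i _ => ?_
  refine Finset.sum_induction _ p hadd h0 fun j _ => ?_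
  exact hadd _ _ (hadd _ _ (hsmul _ _ (hE i j)) (hsmul _ _ (hF i j))) (hsmul _ _ (hM i j))

theorem span_range_gen : Submodule.span ℂ (Set.range (gen (n := n))) = ⊤ := by
  have hg : ∀ g : Gen n, gen g ∈ Submodule.span ℂ (Set.range (gen (n := n))) :=
    fun g => Submodule.subset_span ⟨g, rfl⟩
  refine eq_top_iff.2 fun x _ => ?_
  refine sp_induction (p := fun x => x ∈ Submodule.span ℂ (Set.range (gen (n := n))))
    ?_ ?_ ?_ (Submodule.zero_mem _) (fun x y => Submodule.add_mem _)
    (fun c x => Submodule.smul_mem _ c) x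
  · intro i j
    rcases le_total i j with h | h
    · exact hg (.Ep i j h)
    · rw [Eplus_comm]; exact hg (.Ep j i h)
  · intro i j
    rcases le_total i j with h | h
    · exact hg (.Fp i j h)
    · rw [Fplus_comm]; exact hg (.Fp j i h)
  · intro i j
    rcases lt_trichotomy i j with h | h | h
    · exact hg (.Em i j h)
    · subst h
      have : Eminus i i = (2 : ℂ) • gen (.H i) := by
        rw [gen, Hcartan_eq, smul_smul]; norm_num
      rw [this]
      exact Submodule.smul_mem _ _ (hg _)
    · exact hg (.Fm j i h)

/-- The matrix entry at `(a, b)`. -/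
def entry (n : ℕ) (a b : Fin n ⊕ Fin n) : Sp n →ₗ[ℂ] ℂ where
  toFun M := M.1 a b
  map_add' _ _ := rfl
  map_smul' _ _ := rfl

theorem entry_apply (a b : Fin n ⊕ Fin n) (M : Sp n) : entry n a b M = M.1 a b := rfl

/-- The coordinates with respect to `gen`. -/
noncomputable def coord {n : ℕ} : Gen n → Sp n →ₗ[ℂ] ℂ
  | .Ep i j _ => (if i = j then 1 / 2 else 1 : ℂ) • entry n (.inl i) (.inr j)
  | .Fp i j _ => (if i = j then 1 / 2 else 1 : ℂ) • entry n (.inr i) (.inl j)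
  | .Em i j _ => entry n (.inl i) (.inl j)
  | .Fm i j _ => entry n (.inl j) (.inl i)
  | .H i => (2 : ℂ) • entry n (.inl i) (.inl i)

/-- The functionals `coord` are dual to `gen`: their factors 1/2 and 2 undo the entry 2 of `Eplus i
i` and `Fplus i i` and the entry 1/2 of `Hcartan i`. -/
theorem linearIndependent_gen : LinearIndependent ℂ (gen (n := n)) := by
  refine LinearIndependent.of_pairwise_dual_eq_zero_one _ coord ?_ ?_
  · intro g g' hne
    rcases g with ⟨i, j, h⟩ | ⟨i, j, h⟩ | ⟨i, j, h⟩ | ⟨i, j, h⟩ | i <;>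
    rcases g' with ⟨k, l, h'⟩ | ⟨k, l, h'⟩ | ⟨k, l, h'⟩ | ⟨k, l, h'⟩ | k <;>
    simp only [coord, LinearMap.smul_apply, entry_apply, smul_eq_mul] <;>
    simp [gen, Eplus, Fplus, Eminus, Fminus, Hcartan, Matrix.single_apply] at hne ⊢ <;>
    grind
  · intro g
    rcases g with ⟨i, j, h⟩ | ⟨i, j, h⟩ | ⟨i, j, h⟩ | ⟨i, j, h⟩ | i <;>
    simp only [coord, LinearMap.smul_apply, entry_apply, smul_eq_mul] <;>
    simp [gen, Eplus, Fplus, Eminus, Fminus, Hcartan, Matrix.single_apply] <;>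
    grind

/-- The standard basis of `sp(n)`. -/
noncomputable def genBasis (n : ℕ) : Module.Basis (Gen n) ℂ (Sp n) :=
  Module.Basis.mk linearIndependent_gen span_range_gen.ge

/-- The embedding of the labels of `sp(N-1)` into those of `sp(N)`. -/
def Gen.shift : Gen n → Gen (n + 1)
  | .Ep i j h => .Ep i.succ j.succ (Fin.succ_le_succ_iff.2 h)
  | .Fp i j h => .Fp i.succ j.succ (Fin.succ_le_succ_iff.2 h)
  | .Em i j h => .Em i.succ j.succ (Fin.succ_lt_succ_iff.2 h)
  | .Fm i j h => .Fm i.succ j.succ (Fin.succ_lt_succ_iff.2 h)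
  | .H i => .H i.succ

theorem Gen.shift_injective : Function.Injective (Gen.shift (n := n)) := by
  intro g g' h
  cases g <;> cases g' <;> simp_all [Gen.shift]

theorem constantCoeff_gen' (g : Gen n) : PowerSeries.constantCoeff (gen' g) =
    UniversalEnvelopingAlgebra.ι ℂ (gen g.shift) := by
  cases g <;> simp [gen', gen, Gen.shift, emb]

/-- All corrections are divisible by ξ, so constant terms give part of the standard basis of
`sp(N)`, which `ι` keeps independent. -/
theorem linearIndependent_gen' : LinearIndependent ℂ (gen' (n := n)) := by
  refine LinearIndependent.of_comp (PowerSeries.coeff (R := U (n + 1)) 0 |>.restrictScalars ℂ) ?_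
  have h := (linearIndependent_gen (n := n + 1)).comp _ Gen.shift_injective
  have h' := h.map' (UniversalEnvelopingAlgebra.ι ℂ : Sp (n + 1) →ₗ⁅ℂ⁆ U (n + 1)).toLinearMap
    (LinearMap.ker_eq_bot.2 (ι_injective (n + 1)))
  have e : (PowerSeries.coeff (R := U (n + 1)) 0 |>.restrictScalars ℂ) ∘ gen' (n := n) =
      fun g => UniversalEnvelopingAlgebra.ι ℂ (gen g.shift) := funext fun g =>
    (PowerSeries.coeff_zero_eq_constantCoeff_apply _).trans (constantCoeff_gen' g)
  rw [e]
  exact h'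

end Basis

end SpTwist

namespace SpTwist

attribute [local instance 100] LieRing.ofAssociativeRing

/-! ### The Lie algebra spanned by the modified generators -/

section Modified

variable {n : ℕ}

/-- `E'_{i+j}`. -/
noncomputable def Eplus' (i j : Fin n) : (U (n + 1))⟦X⟧ :=
  emb (Eplus i.succ j.succ) - ξ * (E1p i * E1p j * expσ n (-1))

/-- `F'_{i+j}`. -/
noncomputable def Fplus' (i j : Fin n) : (U (n + 1))⟦X⟧ :=
  emb (Fplus i.succ j.succ) - ξ * (E1m i * E1m j)

/-- `E'_{i-j}`. -/
noncomputable def Eminus' (i j : Fin n) : (U (n + 1))⟦X⟧ := emb (Eminus i.succ j.succ)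

theorem Eplus'_comm (i j : Fin n) : Eplus' i j = Eplus' j i := by
  rw [Eplus', Eplus', Eplus_comm, (commute_E1p_E1p i j).eq]

theorem Fplus'_comm (i j : Fin n) : Fplus' i j = Fplus' j i := by
  rw [Fplus', Fplus', Fplus_comm, (commute_E1m_E1m i j).eq]

theorem add_mul_add_add {A : Type*} [Ring A] (p x t u v : A) :
    p + x * (t + u) + v = p + x * t + x * u + v := by rw [mul_add, ← add_assoc]

theorem add_mul_add_self_add {A : Type*} [Ring A] (p x t v : A) :
    p + x * (t + t) + v = p + 2 * x * t + v := by rw [mul_add, two_mul, add_mul]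

theorem commute_ξ {A : Type*} [Ring A] (x : A⟦X⟧) : Commute x ξ := PowerSeries.commute_X x

theorem lie_Eplus'_Eplus' (i j k l : Fin n) : ⁅Eplus' i j, Eplus' k l⁆ = 0 := by
  have hE : ∀ a b c : Fin n, Commute (emb (Eplus a.succ b.succ)) (E1p c) := fun a b c =>
    (commute_of_lie_eq_zero (lie_E1p_Eplus c a b)).symm
  have hEa : ∀ a b c d : Fin n, Commute (emb (Eplus a.succ b.succ))
      (ξ * (E1p c * E1p d * expσ n (-1))) := fun a b c d =>
    (commute_ξ _).mul_right (((hE a b c).mul_right (hE a b d)).mul_right (commute_Eplus_expσ a b _))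
  have ha : ∀ a c d : Fin n, Commute (E1p a) (ξ * (E1p c * E1p d * expσ n (-1))) := fun a c d =>
    (commute_ξ _).mul_right
      (((commute_E1p_E1p a c).mul_right (commute_E1p_E1p a d)).mul_right (commute_E1p_expσ a _))
  have hc : ∀ c d : Fin n, Commute (expσ n (-1)) (ξ * (E1p c * E1p d * expσ n (-1))) := fun c d =>
    (commute_ξ _).mul_right (((commute_E1p_expσ c _).symm.mul_right
      (commute_E1p_expσ d _).symm).mul_right (Commute.refl _))
  apply lie_eq_zero_of_commute
  refine Commute.sub_left (Commute.sub_right ?_ (hEa i j k l))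
    (Commute.sub_right (hEa k l i j).symm ?_)
  · exact commute_emb (lie_Eplus_Eplus _ _ _ _)
  · exact (commute_ξ _).symm.mul_left (((ha i k l).mul_left (ha j k l)).mul_left (hc k l))

theorem lie_Fplus'_Fplus' (i j k l : Fin n) : ⁅Fplus' i j, Fplus' k l⁆ = 0 := by
  have hE : ∀ a b c : Fin n, Commute (emb (Fplus a.succ b.succ)) (E1m c) := fun a b c =>
    (commute_of_lie_eq_zero (lie_E1m_Fplus c a b)).symm
  have hEa : ∀ a b c d : Fin n, Commute (emb (Fplus a.succ b.succ)) (ξ * (E1m c * E1m d)) :=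
    fun a b c d => (commute_ξ _).mul_right ((hE a b c).mul_right (hE a b d))
  have ha : ∀ a c d : Fin n, Commute (E1m a) (ξ * (E1m c * E1m d)) := fun a c d =>
    (commute_ξ _).mul_right ((commute_E1m_E1m a c).mul_right (commute_E1m_E1m a d))
  apply lie_eq_zero_of_commute
  refine Commute.sub_left (Commute.sub_right ?_ (hEa i j k l))
    (Commute.sub_right (hEa k l i j).symm ?_)
  · exact commute_emb (lie_Fplus_Fplus _ _ _ _)
  · exact (commute_ξ _).symm.mul_left ((ha i k l).mul_left (ha j k l))

theorem lie_Eminus'_Eminus' (i j k l : Fin n) : ⁅Eminus' i j, Eminus' k l⁆ =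
    (if j = k then Eminus' i l else 0) - (if i = l then Eminus' k j else 0) := by
  simp [Eminus', lie_emb, lie_Eminus_Eminus, emb_sub, emb_ite, emb_zero]

theorem lie_Eminus'_Eplus' (i j k l : Fin n) : ⁅Eminus' i j, Eplus' k l⁆ =
    (if j = k then Eplus' i l else 0) + (if j = l then Eplus' i k else 0) := by
  have h : ∀ k, ⁅emb (Eminus i.succ j.succ), E1p k⁆ = if j = k then E1p i else 0 := fun k => by
    rw [← lie_skew, lie_E1p_Eminus, neg_neg]; simp only [@eq_comm _ k]
  rw [Eminus', Eplus', lie_sub, lie_ξ_mul, ring_lie_mul, ring_lie_mul, h, h,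
    lie_eq_zero_of_commute (commute_Eminus_expσ i j _), lie_emb, lie_Eminus_Eplus, emb_add,
    emb_ite, emb_ite, emb_zero]
  simp only [Fin.succ_inj, mul_zero, add_zero, Eplus', (commute_E1p_E1p i k).eq]
  split_ifs <;> simp only [zero_mul, mul_zero, add_zero, zero_add, sub_zero, add_mul, mul_add]
  abel

theorem lie_Eminus'_Fplus' (i j k l : Fin n) : ⁅Eminus' i j, Fplus' k l⁆ =
    -(if i = k then Fplus' j l else 0) - (if i = l then Fplus' j k else 0) := by
  have h : ∀ k, ⁅emb (Eminus i.succ j.succ), E1m k⁆ = -if i = k then E1m j else 0 := fun k => by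
    rw [← lie_skew, lie_E1m_Eminus]; simp only [@eq_comm _ k]
  rw [Eminus', Fplus', lie_sub, lie_ξ_mul, ring_lie_mul, h, h, lie_emb, lie_Eminus_Fplus, emb_sub,
    emb_neg, emb_ite, emb_ite, emb_zero]
  simp only [Fin.succ_inj, Fplus', (commute_E1m_E1m j k).eq]
  split_ifs <;> simp only [neg_zero, zero_mul, mul_zero, add_zero, zero_add, sub_zero, zero_sub,
    add_mul, mul_add, neg_mul, mul_neg, neg_sub] <;> abel

/-- The quadratic element through which the corrections of `E'_{i+j}` and `F'_{k+l}` interact. -/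
noncomputable def mixedTerm (i j k l : Fin n) : (U (n + 1))⟦X⟧ :=
  ((if i = k then E1m l else 0) + (if i = l then E1m k else 0)) * E1p j +
    E1p i * ((if j = k then E1m l else 0) + (if j = l then E1m k else 0))

theorem lie_E1p_E1m (i j : Fin n) : ⁅E1p i, E1m j⁆ = -if i = j then E11 n else 0 := by
  rw [← lie_skew, lie_E1m_E1p]; simp only [@eq_comm _ j]

theorem commute_ite {A : Type*} [Ring A] {p : Prop} [Decidable p] {x y : A} (h : Commute x y) :
    Commute (if p then x else 0) y := by
  split_ifs
  · exact h
  · exact Commute.zero_left y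

theorem commute_mixedTerm_expσ (i j k l : Fin n) (c : ℂ) :
    Commute (mixedTerm i j k l) (expσ n c) :=
  ((((commute_ite (commute_E1m_expσ l c)).add_left
    (commute_ite (commute_E1m_expσ k c))).mul_left (commute_E1p_expσ j c))).add_left
    ((commute_E1p_expσ i c).mul_left ((commute_ite (commute_E1m_expσ l c)).add_left
      (commute_ite (commute_E1m_expσ k c))))

theorem lie_E1p_mul_Fplus (i j k l : Fin n) :
    ⁅E1p i * E1p j, emb (Fplus k.succ l.succ)⁆ = mixedTerm i j k l := by
  rw [ring_mul_lie, lie_E1p_Fplus, lie_E1p_Fplus, mixedTerm]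

/-- The Leibniz rule gives the mixed term up to the order of its factors. The two reorderings
required each cost δ_{ik} δ_{jl} E_{1+1}, with opposite signs. -/
theorem lie_Eplus_E1m_mul (i j k l : Fin n) :
    ⁅emb (Eplus i.succ j.succ), E1m k * E1m l⁆ = -mixedTerm i j k l := by
  have h : ∀ k, ⁅emb (Eplus i.succ j.succ), E1m k⁆ =
      -((if i = k then E1p j else 0) + (if j = k then E1p i else 0)) := fun k => by
    rw [← lie_skew, lie_E1m_Eplus]; simp only [@eq_comm _ k]
  have hc : ∀ a b : Fin n, E1p a * E1m b = E1m b * E1p a - if a = b then E11 n else 0 := by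
    intro a b
    have := lie_E1p_E1m a b
    rw [LieRing.of_associative_ring_bracket, sub_eq_iff_eq_add] at this
    rw [this]; abel
  rw [ring_lie_mul, h, h, mixedTerm]
  simp only [neg_mul, mul_neg, add_mul, mul_add, ite_mul, mul_ite, zero_mul, mul_zero, hc]
  split_ifs <;> abel

theorem lie_E1p_mul_E1m_mul (i j k l : Fin n) :
    ⁅E1p i * E1p j, E1m k * E1m l⁆ = -(E11 n * mixedTerm i j k l) := by
  have h1 : ∀ a, E1p a * E11 n = E11 n * E1p a := fun a => (commute_E1p_E11 a).eq
  have h2 : ∀ a, E1m a * E11 n = E11 n * E1m a := fun a => (commute_E1m_E11 a).eq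
  rw [ring_mul_lie, ring_lie_mul, ring_lie_mul]
  simp only [lie_E1p_E1m, mixedTerm, mul_neg, neg_mul, add_mul, mul_add, ite_mul, mul_ite, zero_mul,
    mul_zero, ← mul_assoc, h1, h2]
  simp only [mul_assoc, h1, h2]
  split_ifs <;> abel

/-- With M the mixed term, the corrections add up to ξM - ξ M e^{-σ} - ξ² E_{1+1} M e^{-σ} = ξM (1 -
(1 + ξ E_{1+1}) e^{-σ}) = 0. This is why E' carries e^{-σ} and F' does not. -/
theorem lie_Eplus'_Fplus' (i j k l : Fin n) : ⁅Eplus' i j, Fplus' k l⁆ =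
    (if j = k then Eminus' i l else 0) + (if j = l then Eminus' i k else 0) +
      (if i = k then Eminus' j l else 0) + (if i = l then Eminus' j k else 0) := by
  have hF : ⁅expσ n (-1), emb (Fplus k.succ l.succ)⁆ = 0 :=
    lie_eq_zero_of_commute (commute_Fplus_expσ k l _).symm
  have hb : ⁅expσ n (-1), E1m k * E1m l⁆ = 0 :=
    lie_eq_zero_of_commute ((commute_E1m_expσ k _).mul_left (commute_E1m_expσ l _)).symm
  have hS := (commute_mixedTerm_expσ i j k l (-1)).eq
  have hw : mixedTerm i j k l = expσ n (-1) * mixedTerm i j k l +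
      ξ * (E11 n * (expσ n (-1) * mixedTerm i j k l)) := by
    have : expσ n 1 * expσ n (-1) = 1 := by rw [← expσ_add, ← expσ_zero]; norm_num
    conv_lhs => rw [← one_mul (mixedTerm i j k l), ← this, expσ_one]
    noncomm_ring
  have hEF : ⁅emb (Eplus i.succ j.succ), emb (Fplus k.succ l.succ)⁆ =
      (if j = k then Eminus' i l else 0) + (if j = l then Eminus' i k else 0) +
      (if i = k then Eminus' j l else 0) + (if i = l then Eminus' j k else 0) := by
    simp [Eminus', lie_emb, lie_Eplus_Fplus, emb_add, emb_ite, emb_zero]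
  rw [Eplus', Fplus', sub_lie, lie_sub, lie_sub, lie_ξ_mul, ξ_mul_lie, ξ_mul_lie, lie_ξ_mul,
    ring_mul_lie _ (expσ n (-1)), ring_mul_lie _ (expσ n (-1)), hF, hb, mul_zero,
    add_zero, add_zero, lie_E1p_mul_Fplus, lie_Eplus_E1m_mul, lie_E1p_mul_E1m_mul, hEF, neg_mul,
    mul_assoc (E11 n), hS, mul_neg, mul_neg, mul_neg]
  conv_lhs => enter [1, 2, 1]; rw [hw]
  rw [mul_add]
  abel

/-- The map `X ↦ X'`. -/
noncomputable def primedₗ (n : ℕ) : Sp n →ₗ[ℂ] (U (n + 1))⟦X⟧ := (genBasis n).constr ℂ gen'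

theorem primedₗ_gen (g : Gen n) : primedₗ n (gen g) = gen' g := by
  have := (genBasis n).constr_basis ℂ gen' g
  rwa [genBasis, Module.Basis.mk_apply] at this

theorem primedₗ_Eplus (i j : Fin n) : primedₗ n (Eplus i j) = Eplus' i j := by
  rcases le_total i j with h | h
  · exact primedₗ_gen (.Ep i j h)
  · rw [Eplus_comm, Eplus'_comm]; exact primedₗ_gen (.Ep j i h)

theorem primedₗ_Fplus (i j : Fin n) : primedₗ n (Fplus i j) = Fplus' i j := by
  rcases le_total i j with h | h
  · exact primedₗ_gen (.Fp i j h)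
  · rw [Fplus_comm, Fplus'_comm]; exact primedₗ_gen (.Fp j i h)

theorem primedₗ_Eminus (i j : Fin n) : primedₗ n (Eminus i j) = Eminus' i j := by
  rcases lt_trichotomy i j with h | h | h
  · exact primedₗ_gen (.Em i j h)
  · subst h
    have h2 : ∀ {N : ℕ} (i : Fin N), Eminus i i = (2 : ℂ) • Hcartan i := fun i => by
      rw [Hcartan_eq, smul_smul]; norm_num
    rw [Eminus', h2, h2, map_smul, emb_smul]
    congr 1
    exact primedₗ_gen (.H i)
  · exact primedₗ_gen (.Fm j i h)

theorem primedₗ_lie (x y : Sp n) : primedₗ n ⁅x, y⁆ = ⁅primedₗ n x, primedₗ n y⁆ := by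
  have swap : ∀ a b : Sp n, primedₗ n ⁅a, b⁆ = ⁅primedₗ n a, primedₗ n b⁆ →
      primedₗ n ⁅b, a⁆ = ⁅primedₗ n b, primedₗ n a⁆ := by
    intro a b h
    rw [← lie_skew, map_neg, h, lie_skew]
  -- Linearity in the left argument; combined with `swap` it also reduces the right argument to root
  -- vectors.
  have step : ∀ y : Sp n, (∀ i j : Fin n, primedₗ n ⁅Eplus i j, y⁆ = ⁅Eplus' i j, primedₗ n y⁆) →
      (∀ i j : Fin n, primedₗ n ⁅Fplus i j, y⁆ = ⁅Fplus' i j, primedₗ n y⁆) →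
      (∀ i j : Fin n, primedₗ n ⁅Eminus i j, y⁆ = ⁅Eminus' i j, primedₗ n y⁆) →
      ∀ x, primedₗ n ⁅x, y⁆ = ⁅primedₗ n x, primedₗ n y⁆ := by
    intro y hE hF hM
    refine sp_induction ?_ ?_ ?_ ?_ ?_ ?_
    · intro i j; rw [hE, primedₗ_Eplus]
    · intro i j; rw [hF, primedₗ_Fplus]
    · intro i j; rw [hM, primedₗ_Eminus]
    · simp
    · intro a b ha hb; simp [ha, hb]
    · intro c a ha; simp [ha]
  have hEE : ∀ i j k l : Fin n, primedₗ n ⁅Eplus i j, Eplus k l⁆ = ⁅Eplus' i j, Eplus' k l⁆ :=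
    fun i j k l => by rw [lie_Eplus_Eplus, lie_Eplus'_Eplus', map_zero]
  have hFF : ∀ i j k l : Fin n, primedₗ n ⁅Fplus i j, Fplus k l⁆ = ⁅Fplus' i j, Fplus' k l⁆ :=
    fun i j k l => by rw [lie_Fplus_Fplus, lie_Fplus'_Fplus', map_zero]
  have hMM : ∀ i j k l : Fin n, primedₗ n ⁅Eminus i j, Eminus k l⁆ =
      ⁅Eminus' i j, Eminus' k l⁆ := fun i j k l => by
    simp only [lie_Eminus_Eminus, lie_Eminus'_Eminus', map_sub, apply_ite (primedₗ n), map_zero,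
      primedₗ_Eminus]
  have hME : ∀ i j k l : Fin n, primedₗ n ⁅Eminus i j, Eplus k l⁆ =
      ⁅Eminus' i j, Eplus' k l⁆ := fun i j k l => by
    simp only [lie_Eminus_Eplus, lie_Eminus'_Eplus', map_add, apply_ite (primedₗ n), map_zero,
      primedₗ_Eplus]
  have hMF : ∀ i j k l : Fin n, primedₗ n ⁅Eminus i j, Fplus k l⁆ =
      ⁅Eminus' i j, Fplus' k l⁆ := fun i j k l => by
    simp only [lie_Eminus_Fplus, lie_Eminus'_Fplus', map_sub, map_neg, apply_ite (primedₗ n),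
      map_zero, primedₗ_Fplus]
  have hEF : ∀ i j k l : Fin n, primedₗ n ⁅Eplus i j, Fplus k l⁆ =
      ⁅Eplus' i j, Fplus' k l⁆ := fun i j k l => by
    simp only [lie_Eplus_Fplus, lie_Eplus'_Fplus', map_add, apply_ite (primedₗ n), map_zero,
      primedₗ_Eminus]
  simp only [← primedₗ_Eplus, ← primedₗ_Fplus, ← primedₗ_Eminus] at step hEE hFF hMM hME hMF hEF
  refine step y (fun i j => ?_) (fun i j => ?_) (fun i j => ?_) x
  · exact swap _ _ (step _ (fun _ _ => hEE _ _ _ _) (fun _ _ => swap _ _ (hEF _ _ _ _))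
      (fun _ _ => hME _ _ _ _) y)
  · exact swap _ _ (step _ (fun _ _ => hEF _ _ _ _) (fun _ _ => hFF _ _ _ _)
      (fun _ _ => hMF _ _ _ _) y)
  · exact swap _ _ (step _ (fun _ _ => swap _ _ (hME _ _ _ _))
      (fun _ _ => swap _ _ (hMF _ _ _ _)) (fun _ _ => hMM _ _ _ _) y)

/-- The map `X ↦ X'` as a homomorphism of Lie algebras. -/
noncomputable def primed (n : ℕ) : Sp n →ₗ⁅ℂ⁆ (U (n + 1))⟦X⟧ :=
  { primedₗ n with map_lie' := fun {x y} => primedₗ_lie x y }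

theorem primed_gen (g : Gen n) : primed n (gen g) = gen' g := primedₗ_gen g

theorem primed_injective : Function.Injective (primed n) := by
  intro x y h
  have h' : (genBasis n).constr ℂ gen' x = (genBasis n).constr ℂ gen' y := h
  rw [Module.Basis.constr_apply, Module.Basis.constr_apply, ← Finsupp.linearCombination_apply,
    ← Finsupp.linearCombination_apply] at h'
  exact (genBasis n).repr.injective (linearIndependent_gen' h')

theorem range_primed : (primed n).range.toSubmodule =
    Submodule.span ℂ (Set.range (gen' (n := n))) := by
  rw [← (genBasis n).constr_range (S := ℂ)]
  rfl

end Modified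

end SpTwist

-- Assembly of the theorem

attribute [local instance 100] LieRing.ofAssociativeRing

open SpTwist
theorem mainTheorem2 (n : ℕ) :
    IsUnit (twist n) ∧
    -- the twisted coproducts of the generators of `sp(N-1)`
    (∀ i : Fin n, comulTw n (emb (Eplus i.succ i.succ)) =
        emb (Eplus i.succ i.succ) ⊠ 1 + 1 ⊠ emb (Eplus i.succ i.succ)
        + 2 * ξ * (E1p i ⊠ (E1p i * expσ n (-1 / 2)))
        + ξ ^ 2 * (E11 n ⊠ (E1p i ^ 2 * expσ n (-1)))) ∧
    (∀ i j : Fin n, i < j → comulTw n (emb (Eplus i.succ j.succ)) =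
        emb (Eplus i.succ j.succ) ⊠ 1 + 1 ⊠ emb (Eplus i.succ j.succ)
        + ξ * (E1p i ⊠ (E1p j * expσ n (-1 / 2)))
        + ξ * (E1p j ⊠ (E1p i * expσ n (-1 / 2)))
        + ξ ^ 2 * (E11 n ⊠ (E1p i * E1p j * expσ n (-1)))) ∧
    (∀ i j : Fin n, i < j → IsPrim (n := n) (emb (Eminus i.succ j.succ))) ∧
    (∀ i : Fin n, comulTw n (emb (Fplus i.succ i.succ)) =
        emb (Fplus i.succ i.succ) ⊠ 1 + 1 ⊠ emb (Fplus i.succ i.succ)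
        + 2 * ξ * (E1m i ⊠ (E1m i * expσ n (-1 / 2)))
        - ξ ^ 2 * ((E1m i ^ 2) ⊠ (E11 n * expσ n (-1)))) ∧
    (∀ i j : Fin n, i < j → comulTw n (emb (Fplus i.succ j.succ)) =
        emb (Fplus i.succ j.succ) ⊠ 1 + 1 ⊠ emb (Fplus i.succ j.succ)
        + ξ * (E1m i ⊠ (E1m j * expσ n (-1 / 2)))
        + ξ * (E1m j ⊠ (E1m i * expσ n (-1 / 2)))
        - ξ ^ 2 * ((E1m i * E1m j) ⊠ (E11 n * expσ n (-1)))) ∧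
    (∀ i j : Fin n, i < j → IsPrim (n := n) (emb (Fminus i.succ j.succ))) ∧
    (∀ i : Fin n, IsPrim (n := n) (emb (Hcartan i.succ))) ∧
    -- the modified generators are primitive
    (∀ g : Gen n, IsPrim (gen' g)) ∧
    -- they are a basis of a Lie algebra isomorphic to `sp(N-1)`
    LinearIndependent ℂ (gen' (n := n)) ∧
    ∃ (L : LieSubalgebra ℂ (U (n + 1))⟦X⟧) (e : Sp n ≃ₗ⁅ℂ⁆ L),
      L.toSubmodule = Submodule.span ℂ (Set.range (gen' (n := n))) ∧
      ∀ g : Gen n, (e (gen g) : (U (n + 1))⟦X⟧) = gen' g := by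
  refine ⟨isUnit_twist, fun i => ?_, fun i j _ => ?_, fun i j _ => isPrim_Eminus i j, fun i => ?_,
    fun i j _ => ?_, fun i j _ => isPrim_Eminus j i, isPrim_Hcartan, isPrim_gen',
    linearIndependent_gen', (primed n).range, LieEquiv.ofInjective (primed n) primed_injective,
    range_primed, primed_gen⟩
  · refine (comulTw_Eplus i i).trans ?_
    rw [pow_two (E1p i)]
    exact add_mul_add_self_add _ _ _ _
  · exact (comulTw_Eplus i j).trans (add_mul_add_add _ _ _ _ _)
  · refine (comulTw_Fplus i i).trans ?_
    rw [pow_two (E1m i), mul_neg, sub_eq_add_neg]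
    exact add_mul_add_self_add _ _ _ _
  · refine (comulTw_Fplus i j).trans ?_
    rw [mul_neg, sub_eq_add_neg]
    exact add_mul_add_add _ _ _ _ _
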